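/- Throughout, $A=\{a_1,\dots,a_n\}\subset\mathbb{Z}^d\smallsetminus\{0\}$ is a finite set such that the cone $\mathbb{R}_{\ge 0}A$ contains no line, and $\Bbbk$ is an infinite field. Let $\mathbb{N}A$ be the semigroup of nonnegative integer combinations of elements of $A$ (not necessarily saturated) and $\Bbbk[\mathbb{N}A]$ its semigroup ring, with monomials $t^a$, $a\in\mathbb{N}A$; a monomial ideal is an ideal generated by monomials. A face of $A$ is a subset $F\subseteq A$ such that $\mathbb{R}_{\ge 0}F$ is a face of $\mathbb{R}_{\ge 0}A$ and $\mathbb{R}_{\ge 0}F\cap A=F$. A standard pair of a monomial ideal $I$ is a pair $(a,F)$, with $a\in\mathbb{N}A$ and $F$ a face of $A$, such that $t^b\notin I$ for all $b\in a+\mathbb{N}F$, and which is maximal among such pairs with respect to inclusion of the sets $a+\mathbb{N}F$. **Theorem.** There is an algorithm that, given $d$, the set $A$ and the (finite) set of all standard pairs of a monomial ideal $I$ in $\Bbbk[\mathbb{N}A]$, outputs an irredundant irreducible decomposition of $I$: it outputs a finite list describing monomial ideals $J_1,\dots,J_m$ of $\Bbbk[\mathbb{N}A]$ such that every $J_i$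 is irreducible (that is, $J_i$ is a proper ideal which is not the intersection of two strictly larger ideals), $I=J_1\cap\dots\cap J_m$, and no $J_i$ can be omitted from this intersection (the empty intersection, $m=0$, being the whole ring). Each component $J_i$ is output as the finite list of its standard pairs together with a finite list of exponents of monomials that generate $J_i$. The algorithm does not depend on $\Bbbk$. -/

import Mathlib

namespace StdPairs

/-! Configurations `A ⊆ ℤ^d`, their semigroups, cones and faces. -/

/-- Lattice points of `ℤ^d`. -/
abbrev Pt (d : ℕ) : Type := Fin d → ℤ

/-- The affine semigroup `ℕA` of nonnegative integer combinations of elements of `A`. -/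
abbrev semigp {d : ℕ} (A : Set (Pt d)) : AddSubmonoid (Pt d) := AddSubmonoid.closure A

/-- A lattice point as a point of `ℝ^d`. -/
def toReal {d : ℕ} (a : Pt d) : Fin d → ℝ := fun i => (a i : ℝ)

/-- The cone `ℝ_{≥0} A`. -/
def realCone {d : ℕ} (A : Set (Pt d)) : PointedCone ℝ (Fin d → ℝ) :=
  PointedCone.hull ℝ (toReal '' A)

/-- `ℝ_{≥0} A` is strongly convex: it contains no line. -/
def StronglyConvex {d : ℕ} (A : Set (Pt d)) : Prop :=
  (realCone A : ConvexCone ℝ (Fin d → ℝ)).Salient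

/-- `F ⊆ A` is a face of `A`: the cone over `F` is a face of the cone over `A`, and it meets `A`
exactly in `F`. -/
structure IsFace {d : ℕ} (A F : Set (Pt d)) : Prop where
  subset : F ⊆ A
  isFaceOf : (realCone F).IsFaceOf (realCone A)
  mem_of_mem_cone : ∀ a ∈ A, toReal a ∈ realCone F → a ∈ F

/-! Pairs `(a, F)`. -/

/-- `(a, F)` is a pair of `A`: `a ∈ ℕA` and `F` is a face of `A`. -/
def IsPair {d : ℕ} (A : Set (Pt d)) (p : Pt d × Set (Pt d)) : Prop :=
  p.1 ∈ semigp A ∧ IsFace A p.2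

/-- The set `a + ℕF` of a pair `(a, F)`. -/
def pairSet {d : ℕ} (p : Pt d × Set (Pt d)) : Set (Pt d) :=
  {x | ∃ f ∈ semigp p.2, x = p.1 + f}

/-! The semigroup ring, monomial ideals and standard pairs. -/

/-- The semigroup ring `k[ℕA]`. -/
abbrev SemigpRing {d : ℕ} (k : Type*) [Field k] (A : Set (Pt d)) : Type _ :=
  AddMonoidAlgebra k (semigp A)

/-- The monomial `t^a`, for `a ∈ ℕA`. -/
noncomputable def mono {d : ℕ} (k : Type*) [Field k] (A : Set (Pt d)) (a : semigp A) :
    SemigpRing k A :=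
  AddMonoidAlgebra.single a 1

/-- A monomial ideal of `k[ℕA]` is an ideal generated by monomials. -/
def IsMonomialIdeal {d : ℕ} {k : Type*} [Field k] {A : Set (Pt d)}
    (I : Ideal (SemigpRing k A)) : Prop :=
  ∃ S : Set (semigp A), I = Ideal.span (mono k A '' S)

/-- The exponents of the standard monomials of `I`. -/
def stdMono {d : ℕ} {k : Type*} [Field k] {A : Set (Pt d)}
    (I : Ideal (SemigpRing k A)) : Set (Pt d) :=
  {x | ∃ a : semigp A, (a : Pt d) = x ∧ mono k A a ∉ I}

/-- A proper pair of `I` is a pair of `A` with `a + ℕF` inside the standard monomials of `I`. -/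
def IsProperPair {d : ℕ} {k : Type*} [Field k] {A : Set (Pt d)}
    (I : Ideal (SemigpRing k A)) (p : Pt d × Set (Pt d)) : Prop :=
  IsPair A p ∧ pairSet p ⊆ stdMono I

/-- The standard pairs of `I`: the proper pairs `(a, F)` that are maximal for the order given by
inclusion of the sets `a + ℕF`. -/
def stdPairs {d : ℕ} {k : Type*} [Field k] {A : Set (Pt d)}
    (I : Ideal (SemigpRing k A)) : Set (Pt d × Set (Pt d)) :=
  {p | IsProperPair I p ∧ ∀ q, IsProperPair I q → pairSet p ⊆ pairSet q → q = p}

/-- The intersection of the finite family `J` is an irredundant irreducible decomposition of `I`.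
(`InfIrred J` says that the ideal `J` is proper and is not the intersection of two strictly
larger ideals.) -/
structure IsIrreducibleDecomposition {R : Type*} [CommRing R] (I : Ideal R) {m : ℕ}
    (J : Fin m → Ideal R) : Prop where
  irreducible : ∀ i, InfIrred (J i)
  iInf_eq : (⨅ i, J i) = I
  irredundant : ∀ i, (⨅ j, ⨅ (_ : j ≠ i), J j) ≠ I

/-! Finite presentations of these objects, and their encodings by lists of integers. -/

/-- The set of entries of a list. -/
def listSet {α : Type*} (l : List α) : Set α := {x | x ∈ l}

/-- The list `P` (whose faces are given by lists of lattice points) enumerates the set `S` of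
pairs. -/
def ListsPairs {d : ℕ} (P : List (Pt d × List (Pt d))) (S : Set (Pt d × Set (Pt d))) : Prop :=
  (fun p : Pt d × List (Pt d) => (p.1, listSet p.2)) '' listSet P = S

/-- The list `G` consists of exponents of monomials of `k[ℕA]` that generate the ideal `J`. -/
def ListsGenerators {d : ℕ} {k : Type*} [Field k] {A : Set (Pt d)}
    (G : List (Pt d)) (J : Ideal (SemigpRing k A)) : Prop :=
  (∀ g ∈ G, g ∈ semigp A) ∧ J = Ideal.span (mono k A '' {a | (a : Pt d) ∈ G})

/-- A lattice point is encoded by the list of its coordinates. -/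
def codePt {d : ℕ} (a : Pt d) : List ℤ := List.ofFn a

/-- Encoding of a list of lattice points. -/
def codePts {d : ℕ} (A : List (Pt d)) : List (List ℤ) := A.map codePt

/-- Encoding of a list of pairs. -/
def codePairs {d : ℕ} (P : List (Pt d × List (Pt d))) : List (List ℤ × List (List ℤ)) :=
  P.map fun p => (codePt p.1, codePts p.2)

/-- Encoding of a list of components, each given by a list of pairs and a list of generators. -/
def codeComponents {d : ℕ} (C : List (List (Pt d × List (Pt d)) × List (Pt d))) :
    List (List (List ℤ × List (List ℤ)) × List (List ℤ)) :=
  C.map fun c => (codePairs c.1, codePts c.2)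

end StdPairs

open StdPairs

namespace StdPairs

/-! Primitive recursive arithmetic of integers. -/

section IntPrimrec

open Encodable

/-! For a pair `(a, F)`, the points `b ∈ ℕA` with `a - b ∈ ℕA - ℕF` are those for which `t^b`
divides some monomial with exponent in `a + ℕF`. They are the standard monomials of an ideal
`irrIdeal`. Every ideal strictly above it contains some `t^a g` with `0 ≠ g ∈ k[ℕF]`
(`CutsOut.exists_mono_mul_mem`). Since `k[ℕF]` is a domain and no nonzero `t^a g` lies in
`irrIdeal`, two strictly larger ideals meet in something larger, so `irrIdeal` is irreducible
(`CutsOut.infIrred_irrIdeal`).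

The standard pairs of `I` cover its standard monomials, so `I` is the intersection of the ideals of
its standard pairs. If the standard set of one pair is covered by those of finitely many others, a
pigeonhole argument along a ray shows that one of them contains it
(`exists_pairLE_of_subset_iUnion`). Hence one representative of each maximal class for `PairLE`
gives an irredundant decomposition (`isIrreducibleDecomposition_irrIdeal`).

The algorithm is an unbounded search for certified output, so no explicit bounds are needed: it
suffices that validity is semidecidable, that valid data exist (`exists_validCode`) and that all
valid data are correct (`ValidCode.exists_entries`). Membership in `ℕA - ℕF` is witnessed by finite
sums. Non-membership is witnessed by a functional, a finite set of remainders and congruences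
(`CutsOut.negCert_iff`). Completeness of a list of standard pairs and generators reduces to finitely
many closure conditions (`IsComponent`). The search sees only lattice points, never the field. -/

theorem encode_int_ofNat (n : ℕ) : encode (n : ℤ) = 2 * n := rfl

theorem encode_int_negSucc (n : ℕ) : encode (Int.negSucc n) = 2 * n + 1 := rfl

/-- The parity of the code of an integer is its sign, so positive and negative parts can be read
off; the other operations go through these two parts. -/
theorem primrec_int_toNat : Primrec Int.toNat := by
  have h : Primrec fun z : ℤ => if encode z % 2 = 0 then encode z / 2 else 0 :=
    Primrec.ite (Primrec.eq.comp (Primrec.nat_mod.comp Primrec.encode (Primrec.const 2))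
      (Primrec.const 0)) (Primrec.nat_div.comp Primrec.encode (Primrec.const 2)) (Primrec.const 0)
  refine h.of_eq fun z => ?_
  cases z with
  | ofNat n =>
    have := encode_int_ofNat n
    simp only [Int.ofNat_eq_natCast, this]
    simp
  | negSucc n =>
    rw [encode_int_negSucc, if_neg (by omega)]
    rfl

theorem primrec_int_neg_toNat : Primrec fun z : ℤ => (-z).toNat := by
  have h : Primrec fun z : ℤ => if encode z % 2 = 0 then 0 else encode z / 2 + 1 :=
    Primrec.ite (Primrec.eq.comp (Primrec.nat_mod.comp Primrec.encode (Primrec.const 2))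
      (Primrec.const 0)) (Primrec.const 0)
      (Primrec.succ.comp (Primrec.nat_div.comp Primrec.encode (Primrec.const 2)))
  refine h.of_eq fun z => ?_
  cases z with
  | ofNat n =>
    have := encode_int_ofNat n
    simp only [Int.ofNat_eq_natCast, this]
    simp
  | negSucc n =>
    rw [encode_int_negSucc, if_neg (by omega)]
    simp only [Int.neg_negSucc]
    omega

theorem primrec_nat_sub_int : Primrec₂ fun m n : ℕ => (m : ℤ) - n := by
  refine Primrec₂.encode_iff.1 ?_
  have h : Primrec fun p : ℕ × ℕ =>
      if p.2 ≤ p.1 then 2 * (p.1 - p.2) else 2 * (p.2 - p.1 - 1) + 1 :=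
    Primrec.ite (Primrec.nat_le.comp .snd .fst)
      (Primrec.nat_mul.comp (.const 2) (Primrec.nat_sub.comp .fst .snd))
      (Primrec.succ.comp (Primrec.nat_mul.comp (.const 2)
        (Primrec.nat_sub.comp (Primrec.nat_sub.comp .snd .fst) (.const 1))))
  refine Primrec.of_eq h fun p => ?_
  obtain ⟨m, n⟩ := p
  by_cases hmn : n ≤ m
  · have : ((m : ℤ) - n) = ((m - n : ℕ) : ℤ) := by omega
    simp only [if_pos hmn, this, encode_int_ofNat]
  · have : ((m : ℤ) - n) = Int.negSucc (n - m - 1) := by omega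
    simp only [if_neg hmn, this, encode_int_negSucc]

theorem primrec_int_add : Primrec₂ fun x y : ℤ => x + y := by
  have h : Primrec fun p : ℤ × ℤ =>
      ((p.1.toNat + p.2.toNat : ℕ) : ℤ) - ((-p.1).toNat + (-p.2).toNat : ℕ) :=
    primrec_nat_sub_int.comp
      (Primrec.nat_add.comp (primrec_int_toNat.comp .fst) (primrec_int_toNat.comp .snd))
      (Primrec.nat_add.comp (primrec_int_neg_toNat.comp .fst) (primrec_int_neg_toNat.comp .snd))
  exact Primrec.of_eq h fun p => by dsimp only; omega

theorem primrec_int_neg : Primrec fun x : ℤ => -x := by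
  have h : Primrec fun p : ℤ => (((-p).toNat : ℕ) : ℤ) - (p.toNat : ℕ) :=
    primrec_nat_sub_int.comp primrec_int_neg_toNat primrec_int_toNat
  exact Primrec.of_eq h fun p => by omega

theorem primrec_int_mul : Primrec₂ fun x y : ℤ => x * y := by
  have h : Primrec fun p : ℤ × ℤ =>
      ((p.1.toNat * p.2.toNat + (-p.1).toNat * (-p.2).toNat : ℕ) : ℤ) -
        (p.1.toNat * (-p.2).toNat + (-p.1).toNat * p.2.toNat : ℕ) :=
    primrec_nat_sub_int.comp
      (Primrec.nat_add.comp
        (Primrec.nat_mul.comp (primrec_int_toNat.comp .fst) (primrec_int_toNat.comp .snd))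
        (Primrec.nat_mul.comp (primrec_int_neg_toNat.comp .fst) (primrec_int_neg_toNat.comp .snd)))
      (Primrec.nat_add.comp
        (Primrec.nat_mul.comp (primrec_int_toNat.comp .fst) (primrec_int_neg_toNat.comp .snd))
        (Primrec.nat_mul.comp (primrec_int_neg_toNat.comp .fst) (primrec_int_toNat.comp .snd)))
  refine Primrec.of_eq h fun p => ?_
  have h1 : p.1 = p.1.toNat - (-p.1).toNat := by omega
  have h2 : p.2 = p.2.toNat - (-p.2).toNat := by omega
  conv_rhs => rw [h1, h2]
  push_cast
  ring

theorem primrec_int_lt : PrimrecRel fun x y : ℤ => x < y := by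
  have h : PrimrecPred fun p : ℤ × ℤ =>
      p.1.toNat + (-p.2).toNat < p.2.toNat + (-p.1).toNat :=
    Primrec.nat_lt.comp
      (Primrec.nat_add.comp (primrec_int_toNat.comp .fst) (primrec_int_neg_toNat.comp .snd))
      (Primrec.nat_add.comp (primrec_int_toNat.comp .snd) (primrec_int_neg_toNat.comp .fst))
  exact PrimrecPred.of_eq h fun p => by omega

end IntPrimrec

/-! Semidecidable predicates, as projections of primitive recursive ones. -/

/-- `p` is the projection of a primitive recursive predicate. -/
def Semidec {α : Type*} [Primcodable α] (p : α → Prop) : Prop :=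
  ∃ R : α × ℕ → Prop, PrimrecPred R ∧ ∀ a, p a ↔ ∃ n, R (a, n)

namespace Semidec

variable {α β : Type*} [Primcodable α] [Primcodable β]

theorem of_primrecPred {p : α → Prop} (h : PrimrecPred p) : Semidec p :=
  ⟨fun x => p x.1, h.comp .fst, fun _ => by simp⟩

theorem and {p q : α → Prop} (hp : Semidec p) (hq : Semidec q) : Semidec fun a => p a ∧ q a := by
  obtain ⟨R, hR, h⟩ := hp
  obtain ⟨S, hS, h'⟩ := hq
  refine ⟨fun x => R (x.1, x.2.unpair.1) ∧ S (x.1, x.2.unpair.2),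
    (hR.comp (Primrec.fst.pair (Primrec.fst.comp (Primrec.unpair.comp .snd)))).and
      (hS.comp (Primrec.fst.pair (Primrec.snd.comp (Primrec.unpair.comp .snd)))), fun a => ?_⟩
  dsimp only
  rw [h, h']
  constructor
  · rintro ⟨⟨m, hm⟩, n, hn⟩
    exact ⟨Nat.pair m n, by simpa using ⟨hm, hn⟩⟩
  · rintro ⟨n, h1, h2⟩
    exact ⟨⟨_, h1⟩, _, h2⟩

theorem or {p q : α → Prop} (hp : Semidec p) (hq : Semidec q) : Semidec fun a => p a ∨ q a := by
  obtain ⟨R, hR, h⟩ := hp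
  obtain ⟨S, hS, h'⟩ := hq
  exact ⟨fun x => R x ∨ S x, hR.or hS, fun a => by dsimp only; rw [h, h', ← exists_or]⟩

theorem ex {p : α → β → Prop} (h : Semidec fun x : α × β => p x.1 x.2) :
    Semidec fun a => ∃ b, p a b := by
  classical
  obtain ⟨R, hR, h⟩ := h
  refine ⟨fun x => ((Encodable.decode x.2.unpair.1 : Option β).elim false
    fun b => decide (R ((x.1, b), x.2.unpair.2))) = true, ?_, fun a => ?_⟩
  · refine Primrec.eq.comp ?_ (Primrec.const true)
    have h1 : Primrec fun x : α × ℕ => (Encodable.decode x.2.unpair.1 : Option β) :=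
      Primrec.decode.comp (Primrec.fst.comp (Primrec.unpair.comp .snd))
    have h2 : Primrec₂ fun (x : α × ℕ) (b : β) => decide (R ((x.1, b), x.2.unpair.2)) :=
      hR.decide.comp (((Primrec.fst.comp .fst).pair .snd).pair
        (Primrec.snd.comp (Primrec.unpair.comp (Primrec.snd.comp .fst))))
    refine (Primrec.option_casesOn h1 (Primrec.const false) h2).of_eq fun x => ?_
    cases (Encodable.decode x.2.unpair.1 : Option β) <;> rfl
  · constructor
    · rintro ⟨b, hb⟩
      obtain ⟨n, hn⟩ := (h (a, b)).1 hb
      exact ⟨Nat.pair (Encodable.encode b) n, by simpa using hn⟩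
    · rintro ⟨n, hn⟩
      dsimp only at hn
      cases hd : (Encodable.decode n.unpair.1 : Option β) with
      | none => simp [hd] at hn
      | some b =>
        rw [hd] at hn
        exact ⟨b, (h (a, b)).2 ⟨_, by simpa using hn⟩⟩

theorem all_mem {p : α → β → Prop} {l : α → List β} (hl : Primrec l)
    (h : Semidec fun x : α × β => p x.1 x.2) : Semidec fun a => ∀ b ∈ l a, p a b := by
  obtain ⟨R, hR, h⟩ := h
  have h1 : PrimrecRel fun (n : ℕ) (x : α × β) => ∃ k < n, R (x, k) := by
    have : PrimrecRel fun (k : ℕ) (x : α × β) => R (x, k) := hR.comp (Primrec.snd.pair .fst)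
    exact (this.exists_mem_list.comp (Primrec.list_range.comp .fst) .snd).of_eq (by simp)
  have h2 : PrimrecRel fun (b : β) (x : α × ℕ) => ∃ k < x.2, R ((x.1, b), k) :=
    h1.comp (Primrec.snd.comp .snd) ((Primrec.fst.comp .snd).pair .fst)
  refine ⟨fun x => ∀ b ∈ l x.1, ∃ k < x.2, R ((x.1, b), k),
    h2.forall_mem_list.comp (hl.comp .fst) .id, fun a => ?_⟩
  constructor
  · intro hp
    have : ∀ b ∈ l a, ∃ k, R ((a, b), k) := fun b hb => (h (a, b)).1 (hp b hb)
    choose! k hk using this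
    -- The sum plus one strictly bounds all the individual witnesses at once.
    refine ⟨((l a).map k).sum + 1, fun b hb => ⟨k b, ?_, hk b hb⟩⟩
    exact Nat.lt_succ_of_le (List.le_sum_of_mem (List.mem_map_of_mem hb))
  · rintro ⟨n, hn⟩ b hb
    obtain ⟨k, -, hk⟩ := hn b hb
    exact (h (a, b)).2 ⟨k, hk⟩

theorem mem {l : α → List β} {b : α → β} (hb : Primrec b) (hl : Primrec l) :
    Semidec fun a => b a ∈ l a := by
  have h : PrimrecRel fun (x y : β) => x = y := Primrec.eq
  exact of_primrecPred ((h.exists_mem_list.comp hl hb).of_eq fun a => by simp)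

theorem ex_mem {p : α → β → Prop} {l : α → List β} (hl : Primrec l)
    (h : Semidec fun x : α × β => p x.1 x.2) : Semidec fun a => ∃ b ∈ l a, p a b :=
  ex (p := fun a b => b ∈ l a ∧ p a b) ((mem .snd (hl.comp .fst)).and h)

/-- A semidecidable relation is uniformized by a partial recursive function. -/
theorem exists_partrec {p : α → β → Prop} (h : Semidec fun x : α × β => p x.1 x.2) :
    ∃ f : α →. β, Partrec f ∧ ∀ a, (∃ b, p a b) → ∃ b ∈ f a, p a b := by
  classical
  obtain ⟨R, hR, h⟩ := h
  -- Dovetailing: `n` codes both a candidate output and a witness for its validity.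
  let g : α → ℕ → Option β := fun a n => (Encodable.decode n.unpair.1 : Option β).bind
    fun b => if R ((a, b), n.unpair.2) then some b else none
  have hg : Primrec₂ g := by
    have h1 : Primrec fun x : α × ℕ => (Encodable.decode x.2.unpair.1 : Option β) :=
      Primrec.decode.comp (Primrec.fst.comp (Primrec.unpair.comp .snd))
    have h2 : Primrec₂ fun (x : α × ℕ) (b : β) =>
        if R ((x.1, b), x.2.unpair.2) then some b else none :=
      Primrec.ite (hR.comp (((Primrec.fst.comp .fst).pair .snd).pair
        (Primrec.snd.comp (Primrec.unpair.comp (Primrec.snd.comp .fst)))))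
        (Primrec.option_some.comp .snd) (Primrec.const none)
    exact Primrec.option_bind h1 h2
  have hgp : ∀ a n b, b ∈ g a n → p a b := by
    intro a n b hb
    obtain ⟨b', -, h2⟩ := Option.bind_eq_some_iff.1 hb
    split_ifs at h2 with hr
    cases h2
    exact (h (a, b)).2 ⟨_, hr⟩
  refine ⟨fun a => Nat.rfindOpt (g a), Partrec.rfindOpt hg.to_comp, fun a ⟨b, hb⟩ => ?_⟩
  obtain ⟨n, hn⟩ := (h (a, b)).1 hb
  have hdom : (Nat.rfindOpt (g a)).Dom := by
    refine Nat.rfindOpt_dom.2 ⟨Nat.pair (Encodable.encode b) n, b, ?_⟩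
    simp only [g, Nat.unpair_pair, Encodable.encodek, Option.bind_some, if_pos hn]
    rfl
  obtain ⟨m, hm⟩ := Nat.rfindOpt_spec (Part.get_mem hdom)
  exact ⟨_, Part.get_mem hdom, hgp a m _ hm⟩

end Semidec

end StdPairs

namespace StdPairs

/-! Integral functionals cutting out faces. -/

/-- **Gordan's theorem**: finitely many vectors of a rational vector space without a nontrivial
nonnegative relation lie in an open half space. -/
theorem exists_forall_pos_of_no_relation {ι : Type*} (s : Finset ι) :
    ∀ {E : Type*} [AddCommGroup E] [Module ℚ E] (v : ι → E),
      (∀ c : ι → ℚ, (∀ i ∈ s, 0 ≤ c i) → ∑ i ∈ s, c i • v i = 0 → ∀ i ∈ s, c i = 0) →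
      ∃ g : E →ₗ[ℚ] ℚ, ∀ i ∈ s, 0 < g (v i) := by
  classical
  induction s using Finset.induction_on with
  | empty => exact fun v _ => ⟨0, by simp⟩
  | insert j s hj ih =>
    intro E _ _ v h
    have sum_update (c : ι → ℚ) (t : ℚ) :
        ∑ i ∈ s, Function.update c j t i • v i = ∑ i ∈ s, c i • v i :=
      Finset.sum_congr rfl fun i hi => by
        rw [Function.update_of_ne (by rintro rfl; exact hj hi)]
    have nonneg_update (c : ι → ℚ) (t : ℚ) (hc : ∀ i ∈ s, 0 ≤ c i) (ht : 0 ≤ t) :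
        ∀ i ∈ insert j s, 0 ≤ Function.update c j t i := by
      intro i hi
      rcases eq_or_ne i j with rfl | hij
      · simpa using ht
      · rw [Function.update_of_ne hij]
        exact hc i ((Finset.mem_insert.1 hi).resolve_left hij)
    have key (c : ι → ℚ) (t : ℚ) (hc : ∀ i ∈ s, 0 ≤ c i) (ht : 0 ≤ t)
        (h0 : t • v j + ∑ i ∈ s, c i • v i = 0) : t = 0 ∧ ∀ i ∈ s, c i = 0 := by
      have := h (Function.update c j t) (nonneg_update c t hc ht) (by
        rw [Finset.sum_insert hj, sum_update, Function.update_self, h0])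
      refine ⟨by simpa using this j (Finset.mem_insert_self _ _), fun i hi => ?_⟩
      have h2 := this i (Finset.mem_insert_of_mem hi)
      rwa [Function.update_of_ne (by rintro rfl; exact hj hi)] at h2
    -- Compare with the quotient by `v j`. Without relations there, a functional vanishing on `v j`
    -- is positive on `s`, and a large multiple of it absorbs a functional that is `1` on `v j`.
    by_cases hq : ∀ c : ι → ℚ, (∀ i ∈ s, 0 ≤ c i) →
        ∑ i ∈ s, c i • (Submodule.span ℚ {v j}).mkQ (v i) = 0 → ∀ i ∈ s, c i = 0
    · obtain ⟨g, hg⟩ := ih (fun i => (Submodule.span ℚ {v j}).mkQ (v i)) hq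
      have hvj : v j ≠ 0 := fun h0 => by
        simpa using (key 0 1 (by simp) zero_le_one (by simp [h0])).1
      obtain ⟨g', hg'⟩ := Module.Projective.exists_dual_ne_zero ℚ hvj
      let g₂ : E →ₗ[ℚ] ℚ := (g' (v j))⁻¹ • g'
      have hg₂ : g₂ (v j) = 1 := by simp [g₂, hg']
      let g₁ : E →ₗ[ℚ] ℚ := g ∘ₗ (Submodule.span ℚ {v j}).mkQ
      have hg₁j : g₁ (v j) = 0 := by
        have : (Submodule.span ℚ {v j}).mkQ (v j) = 0 := by
          rw [Submodule.mkQ_apply, Submodule.Quotient.mk_eq_zero]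
          exact Submodule.mem_span_singleton_self _
        simp only [g₁, LinearMap.comp_apply, this, map_zero]
      have hg₁ : ∀ i ∈ s, 0 < g₁ (v i) := hg
      refine ⟨(1 + ∑ i ∈ s, |g₂ (v i)| / g₁ (v i)) • g₁ + g₂, fun i hi => ?_⟩
      rw [LinearMap.add_apply, LinearMap.smul_apply, smul_eq_mul]
      rcases Finset.mem_insert.1 hi with rfl | hi
      · rw [hg₁j, hg₂]; norm_num
      · have h1 : |g₂ (v i)| / g₁ (v i) ≤ ∑ i ∈ s, |g₂ (v i)| / g₁ (v i) :=
          Finset.single_le_sum (f := fun i => |g₂ (v i)| / g₁ (v i))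
            (fun k hk => div_nonneg (abs_nonneg _) (hg₁ k hk).le) hi
        have h2 := hg₁ i hi
        have h3 : |g₂ (v i)| = |g₂ (v i)| / g₁ (v i) * g₁ (v i) := by field_simp
        have h4 := neg_abs_le (g₂ (v i))
        have h5 := mul_le_mul_of_nonneg_right h1 h2.le
        linarith
    · push Not at hq
      obtain ⟨c, hc, h0, i₀, hi₀, hci₀⟩ := hq
      have hmem : ∑ i ∈ s, c i • v i ∈ Submodule.span ℚ {v j} := by
        rw [← Submodule.Quotient.mk_eq_zero, ← Submodule.mkQ_apply, map_sum]
        simpa using h0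
      obtain ⟨t, ht⟩ := Submodule.mem_span_singleton.1 hmem
      -- A relation modulo `v j` reads `t • v j = ∑ c i • v i`; for `t ≤ 0` it would be a forbidden
      -- relation. So a functional positive on `s` is positive on `v j` too.
      have htpos : 0 < t := by
        by_contra hneg
        exact hci₀ ((key c (-t) hc (by linarith) (by rw [← ht]; module)).2 i₀ hi₀)
      obtain ⟨g, hg⟩ := ih v fun c' hc' h0' => (key c' 0 hc' le_rfl (by simp [h0'])).2
      refine ⟨g, fun i hi => ?_⟩
      rcases Finset.mem_insert.1 hi with rfl | hi
      · have h1 : t * g (v i) = ∑ k ∈ s, c k * g (v k) := by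
          simpa using congrArg g ht
        have h2 : 0 < ∑ k ∈ s, c k * g (v k) :=
          Finset.sum_pos' (fun k hk => mul_nonneg (hc k hk) (hg k hk).le)
            ⟨i₀, hi₀, mul_pos (lt_of_le_of_ne (hc i₀ hi₀) (Ne.symm hci₀)) (hg i₀ hi₀)⟩
        rw [← h1] at h2
        exact pos_of_mul_pos_right h2 htpos.le
      · exact hg i hi

/-- A finite family of rational numbers has a positive common denominator. -/
theorem exists_common_denominator {ι : Type*} [Finite ι] (r : ι → ℚ) :
    ∃ q : ℤ, 0 < q ∧ ∃ y : ι → ℤ, ∀ i, (y i : ℚ) = q * r i := by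
  obtain ⟨b, hb⟩ := IsLocalization.exist_integer_multiples_of_finite (nonZeroDivisors ℤ) r
  choose y hy using hb
  have hb0 : (b : ℤ) ≠ 0 := nonZeroDivisors.coe_ne_zero b
  -- Squaring the common denominator makes it positive.
  refine ⟨b * b, mul_self_pos.2 hb0, fun i => b * y i, fun i => ?_⟩
  have := hy i
  simp only [algebraMap_int_eq, eq_intCast, zsmul_eq_mul] at this
  push_cast
  rw [this]
  ring

variable {d : ℕ}

/-- `ℓ` is an integral functional that is positive on `A` outside `F`, and zero on `F ⊆ A`. -/
structure CutsOut (A F : Set (Pt d)) (ℓ : Pt d) : Prop where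
  subset : F ⊆ A
  eq_zero : ∀ f ∈ F, ℓ ⬝ᵥ f = 0
  pos : ∀ a ∈ A, a ∉ F → 0 < ℓ ⬝ᵥ a

theorem toReal_mem_realCone {F : Set (Pt d)} {x : Pt d} (hx : x ∈ semigp F) :
    toReal x ∈ realCone F := by
  induction hx using AddSubmonoid.closure_induction with
  | mem x hx => exact Submodule.subset_span ⟨x, hx, rfl⟩
  | zero =>
    convert! (realCone F).zero_mem
    ext i
    simp [toReal]
  | add x y _ _ hx hy =>
    convert! (realCone F).add_mem hx hy
    ext i
    simp [toReal]

theorem smul_mem_realCone {F : Set (Pt d)} {x : Fin d → ℝ} {c : ℝ} (hc : 0 ≤ c)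
    (hx : x ∈ realCone F) : c • x ∈ realCone F :=
  PointedCone.smul_mem _ hc hx

/-- Passes from rational linear algebra, where functionals can be made integral, to the real cones
in which faces are defined. -/
theorem exists_sub_of_mem_span_rat {F : Set (Pt d)} {x : Fin d → ℚ}
    (hx : x ∈ Submodule.span ℚ ((fun (f : Pt d) i => (f i : ℚ)) '' F)) :
    ∃ p ∈ realCone F, ∃ q ∈ realCone F, (fun i => (x i : ℝ)) + q = p := by
  induction hx using Submodule.span_induction with
  | mem x hx =>
    obtain ⟨f, hf, rfl⟩ := hx
    refine ⟨toReal f, Submodule.subset_span ⟨f, hf, rfl⟩, 0, Submodule.zero_mem _, ?_⟩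
    ext i
    simp [toReal]
  | zero =>
    refine ⟨0, Submodule.zero_mem _, 0, Submodule.zero_mem _, ?_⟩
    ext i
    simp
  | add x y _ _ hx hy =>
    obtain ⟨p, hp, q, hq, h⟩ := hx
    obtain ⟨p', hp', q', hq', h'⟩ := hy
    refine ⟨p + p', Submodule.add_mem _ hp hp', q + q', Submodule.add_mem _ hq hq', ?_⟩
    rw [← h, ← h']
    ext i
    simp only [Pi.add_apply]
    push_cast
    ring
  | smul a x _ hx =>
    obtain ⟨p, hp, q, hq, h⟩ := hx
    rcases le_total 0 a with ha | ha
    · have ha' : (0 : ℝ) ≤ a := by exact_mod_cast ha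
      refine ⟨_, smul_mem_realCone ha' hp, _, smul_mem_realCone ha' hq, ?_⟩
      rw [← h]
      ext i
      simp [mul_add]
    · have ha' : (0 : ℝ) ≤ -a := by
        have : (a : ℝ) ≤ 0 := by exact_mod_cast ha
        linarith
      refine ⟨_, smul_mem_realCone ha' hq, _, smul_mem_realCone ha' hp, ?_⟩
      rw [← h]
      ext i
      simp

/-- Faces are cut out by integral functionals. -/
theorem IsFace.exists_cutsOut {A F : Set (Pt d)} (hA : A.Finite) (h : IsFace A F) :
    ∃ ℓ : Pt d, CutsOut A F ℓ := by
  classical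
  let ρ : Pt d → Fin d → ℚ := fun a i => (a i : ℚ)
  let N : Submodule ℚ (Fin d → ℚ) := Submodule.span ℚ (ρ '' F)
  have hs : (A \ F).Finite := hA.subset Set.sdiff_subset
  -- Gordan modulo the span of `F`. In a nonnegative relation there, a combination of points outside
  -- `F` lies in the span of `F`, hence in the cone of `F` after adding an element `q` of that cone.
  -- The face property then puts every point with positive coefficient into `F`.
  obtain ⟨g, hg⟩ := exists_forall_pos_of_no_relation hs.toFinset (fun a => N.mkQ (ρ a)) (by
    intro c hc h0 a₀ ha₀
    have hmem : ∑ a ∈ hs.toFinset, c a • ρ a ∈ N := by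
      rw [← Submodule.Quotient.mk_eq_zero, ← Submodule.mkQ_apply, map_sum]
      simpa using h0
    by_contra hne
    have hpos : 0 < c a₀ := lt_of_le_of_ne (hc _ ha₀) (Ne.symm hne)
    have ha₀' := (Set.Finite.mem_toFinset hs).1 ha₀
    obtain ⟨p, hp, q, hq, hpq⟩ := exists_sub_of_mem_span_rat hmem
    have hcone : ∀ {a}, a ∈ A → toReal a ∈ realCone A :=
      fun ha => Submodule.subset_span ⟨_, ha, rfl⟩
    refine ha₀'.2 (h.mem_of_mem_cone _ ha₀'.1 (h.isFaceOf.mem_of_smul_add_mem (a := (c a₀ : ℝ))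
      (y := ∑ a ∈ hs.toFinset.erase a₀, (c a : ℝ) • toReal a + q) (hcone ha₀'.1)
      (Submodule.add_mem _ (Submodule.sum_mem _ fun a ha => ?_) (h.isFaceOf.le hq))
      (by exact_mod_cast hpos) ?_))
    · have ha := Finset.mem_of_mem_erase ha
      exact smul_mem_realCone (by exact_mod_cast hc a ha)
        (hcone ((Set.Finite.mem_toFinset hs).1 ha).1)
    · rw [← add_assoc, Finset.add_sum_erase _ (fun a => (c a : ℝ) • toReal a) ha₀]
      convert! hp
      rw [← hpq]
      congr 1
      ext i
      simp [ρ, toReal])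
  obtain ⟨q, hq, y, hy⟩ := exists_common_denominator fun i =>
    g (N.mkQ (fun j => if i = j then 1 else 0))
  have hval : ∀ a : Pt d, ((y ⬝ᵥ a : ℤ) : ℚ) = q * g (N.mkQ (ρ a)) := by
    intro a
    have h1 := LinearMap.pi_apply_eq_sum_univ (g ∘ₗ N.mkQ) (ρ a)
    simp only [LinearMap.comp_apply] at h1
    rw [h1, Finset.mul_sum, dotProduct]
    push_cast
    refine Finset.sum_congr rfl fun i _ => ?_
    rw [hy i, smul_eq_mul]
    simp only [ρ]
    ring
  refine ⟨y, h.subset, fun f hf => ?_, fun a ha haF => ?_⟩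
  · have : N.mkQ (ρ f) = 0 := by
      rw [Submodule.mkQ_apply, Submodule.Quotient.mk_eq_zero]
      exact Submodule.subset_span ⟨f, hf, rfl⟩
    have h1 := hval f
    rw [this, map_zero, mul_zero] at h1
    exact_mod_cast h1
  · have h1 := hval a
    have h2 := hg a ((Set.Finite.mem_toFinset hs).2 ⟨ha, haF⟩)
    have h3 : (0 : ℚ) < ((y ⬝ᵥ a : ℤ) : ℚ) := by
      rw [h1]
      exact mul_pos (by exact_mod_cast hq) h2
    exact_mod_cast h3

/-- The apex is a face exactly because the cone contains no line. Cutting it out yields a functional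
positive on all of `A`, the grading behind the finiteness arguments below. -/
theorem isFace_empty {A : Set (Pt d)} (hA : ∀ a ∈ A, a ≠ 0) (h : StronglyConvex A) :
    IsFace A ∅ := by
  have hbot : realCone (∅ : Set (Pt d)) = ⊥ := by simp [realCone]
  refine ⟨Set.empty_subset _, ⟨by rw [hbot]; exact bot_le, ?_⟩, fun a ha h0 => ?_⟩
  · intro x y a hx hy ha hxy
    rw [hbot] at hxy ⊢
    have hxy := (Submodule.mem_bot _).1 hxy
    refine (Submodule.mem_bot _).2 ?_
    by_contra hx0
    refine h (a • x) (smul_mem_realCone ha.le hx) (smul_ne_zero ha.ne' hx0) ?_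
    rwa [neg_eq_of_add_eq_zero_right hxy]
  · rw [hbot] at h0
    have h0 := (Submodule.mem_bot _).1 h0
    refine absurd ?_ (hA a ha)
    ext i
    have := congrFun h0 i
    simpa [toReal] using this

/-- A lattice point outside a subgroup is separated from it by a congruence. -/
theorem exists_separating_congruence {F : Set (Pt d)} {z : Pt d}
    (hz : z ∉ AddSubgroup.closure F) :
    ∃ (y : Pt d) (q : ℤ), 0 < q ∧ (∀ f ∈ F, q ∣ y ⬝ᵥ f) ∧ ¬ q ∣ y ⬝ᵥ z := by
  let N := AddSubgroup.closure F
  have hz' : (QuotientAddGroup.mk' N z) ≠ 0 := by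
    rwa [Ne, QuotientAddGroup.mk'_apply, QuotientAddGroup.eq_zero_iff]
  -- Characters into `ℚ/ℤ` separate the points of the quotient by the subgroup. Lifting the values
  -- on a basis to `ℚ` and clearing denominators turns vanishing of the character into divisibility
  -- by `q`.
  obtain ⟨c, hc⟩ := CharacterModule.exists_character_apply_ne_zero_of_ne_zero hz'
  let χ : Pt d →+ AddCircle (1 : ℚ) := AddMonoidHom.comp c (QuotientAddGroup.mk' N)
  choose r hr using fun i => QuotientAddGroup.mk_surjective (χ (Pi.single i 1))
  obtain ⟨q, hq, y, hy⟩ := exists_common_denominator r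
  have hχ : ∀ x : Pt d, χ x = ((∑ i, x i * r i : ℚ) : AddCircle (1 : ℚ)) := by
    intro x
    have hx : x = ∑ i, x i • (Pi.single i 1 : Pt d) := by
      ext j
      simp [Finset.sum_apply, Pi.single_apply]
    conv_lhs => rw [hx]
    rw [map_sum, show ((∑ i, x i * r i : ℚ) : AddCircle (1 : ℚ)) =
      ∑ i, ((x i * r i : ℚ) : AddCircle (1 : ℚ)) from
        map_sum (QuotientAddGroup.mk' (AddSubgroup.zmultiples (1 : ℚ))) _ _]
    refine Finset.sum_congr rfl fun i _ => ?_
    rw [map_zsmul, ← hr i, ← zsmul_eq_mul]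
    rfl
  have hdvd : ∀ x : Pt d, χ x = 0 ↔ q ∣ y ⬝ᵥ x := by
    intro x
    have h1 : ((y ⬝ᵥ x : ℤ) : ℚ) = q * ∑ i, x i * r i := by
      rw [dotProduct, Finset.mul_sum]
      push_cast
      refine Finset.sum_congr rfl fun i _ => ?_
      rw [hy i]
      ring
    have hq' : (q : ℚ) ≠ 0 := by exact_mod_cast hq.ne'
    rw [hχ, AddCircle.coe_eq_zero_iff]
    constructor
    · rintro ⟨n, hn⟩
      refine ⟨n, ?_⟩
      rw [← hn] at h1
      have : ((y ⬝ᵥ x : ℤ) : ℚ) = ((q * n : ℤ) : ℚ) := by rw [h1]; simp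
      exact_mod_cast this
    · rintro ⟨n, hn⟩
      refine ⟨n, ?_⟩
      rw [hn] at h1
      push_cast at h1
      have := mul_left_cancel₀ hq' h1
      simpa using this
  refine ⟨y, q, hq, fun f hf => (hdvd f).1 ?_, fun h => hc ((hdvd z).2 h)⟩
  have : QuotientAddGroup.mk' N f = 0 := by
    rw [QuotientAddGroup.mk'_apply, QuotientAddGroup.eq_zero_iff]
    exact AddSubgroup.subset_closure hf
  change c (QuotientAddGroup.mk' N f) = 0
  rw [this, map_zero]

end StdPairs

namespace StdPairs

variable {d : ℕ}

/-! Localizations of `ℕA` along faces. -/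

/-- The monoid `ℕA - ℕF`. -/
def loc (A F : Set (Pt d)) : AddSubmonoid (Pt d) where
  carrier := {x | ∃ f ∈ semigp F, x + f ∈ semigp A}
  zero_mem' := ⟨0, zero_mem _, by simp⟩
  add_mem' := by
    rintro x y ⟨f, hf, hx⟩ ⟨g, hg, hy⟩
    refine ⟨f + g, add_mem hf hg, ?_⟩
    rw [add_add_add_comm]
    exact add_mem hx hy

theorem mem_loc {A F : Set (Pt d)} {x : Pt d} :
    x ∈ loc A F ↔ ∃ f ∈ semigp F, x + f ∈ semigp A := Iff.rfl

theorem mem_loc_of_mem_semigp {A F : Set (Pt d)} {x : Pt d} (hx : x ∈ semigp A) : x ∈ loc A F :=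
  ⟨0, zero_mem _, by simpa⟩

theorem neg_mem_loc {A F : Set (Pt d)} {x : Pt d} (hx : x ∈ semigp F) : -x ∈ loc A F :=
  ⟨x, hx, by simp⟩

theorem mem_loc_empty {A : Set (Pt d)} {x : Pt d} : x ∈ loc A ∅ ↔ x ∈ semigp A := by
  simp [mem_loc, semigp]

theorem loc_mono {A F G : Set (Pt d)} (h : F ⊆ G) : loc A F ≤ loc A G := by
  rintro x ⟨f, hf, hx⟩
  exact ⟨f, AddSubmonoid.closure_mono h hf, hx⟩

namespace CutsOut

variable {A F : Set (Pt d)} {ℓ : Pt d} (h : CutsOut A F ℓ)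
include h

theorem semigp_le : semigp F ≤ semigp A := AddSubmonoid.closure_mono h.subset

theorem nonneg_of_mem {a : Pt d} (ha : a ∈ A) : 0 ≤ ℓ ⬝ᵥ a := by
  by_cases haF : a ∈ F
  · exact (h.eq_zero a haF).ge
  · exact (h.pos a ha haF).le

theorem nonneg {m : Pt d} (hm : m ∈ semigp A) : 0 ≤ ℓ ⬝ᵥ m := by
  induction hm using AddSubmonoid.closure_induction with
  | mem x hx => exact h.nonneg_of_mem hx
  | zero => simp
  | add x y _ _ hx hy => rw [dotProduct_add]; exact add_nonneg hx hy

theorem dot_eq_zero {m : Pt d} (hm : m ∈ semigp F) : ℓ ⬝ᵥ m = 0 := by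
  induction hm using AddSubmonoid.closure_induction with
  | mem x hx => exact h.eq_zero x hx
  | zero => simp
  | add x y _ _ hx hy => rw [dotProduct_add, hx, hy, add_zero]

theorem mem_semigp_of_nonpos {m : Pt d} (hm : m ∈ semigp A) (h0 : ℓ ⬝ᵥ m ≤ 0) :
    m ∈ semigp F := by
  induction hm using AddSubmonoid.closure_induction with
  | mem x hx =>
    refine AddSubmonoid.subset_closure ?_
    by_contra hxF
    exact absurd (h.pos x hx hxF) (not_lt.2 h0)
  | zero => exact zero_mem _
  | add x y hx hy ihx ihy =>
    rw [dotProduct_add] at h0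
    have := h.nonneg hx
    have := h.nonneg hy
    exact add_mem (ihx (by linarith)) (ihy (by linarith))

theorem nonneg_of_mem_loc {x : Pt d} (hx : x ∈ loc A F) : 0 ≤ ℓ ⬝ᵥ x := by
  obtain ⟨f, hf, hx⟩ := hx
  have := h.nonneg hx
  rwa [dotProduct_add, h.dot_eq_zero hf, add_zero] at this

/-- On `ℕA - ℕF` the functional is nonnegative, and its zero level is just the group generated by
`F`. -/
theorem exists_add_eq_of_mem_loc {x : Pt d} (hx : x ∈ loc A F) (h0 : ℓ ⬝ᵥ x ≤ 0) :
    ∃ f ∈ semigp F, ∃ g ∈ semigp F, x + f = g := by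
  obtain ⟨f, hf, hx⟩ := hx
  refine ⟨f, hf, _, h.mem_semigp_of_nonpos hx ?_, rfl⟩
  rwa [dotProduct_add, h.dot_eq_zero hf, add_zero]

end CutsOut

theorem CutsOut.eq_zero_of_add_eq_zero {A : Set (Pt d)} {h : Pt d} (hh : CutsOut A ∅ h)
    {x y : Pt d} (hx : x ∈ semigp A) (hy : y ∈ semigp A) (hxy : x + y = 0) : x = 0 := by
  have h1 := hh.nonneg hy
  have h2 : h ⬝ᵥ x + h ⬝ᵥ y = 0 := by rw [← dotProduct_add, hxy, dotProduct_zero]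
  have := hh.mem_semigp_of_nonpos hx (by linarith)
  simpa [semigp] using this

/-- Only finitely many elements of the semigroup lie under a given level of a positive
functional. -/
theorem finite_semigp_le {S : Set (Pt d)} (hS : S.Finite) {h : Pt d}
    (hpos : ∀ a ∈ S, 0 < h ⬝ᵥ a) (n : ℤ) : {x | x ∈ semigp S ∧ h ⬝ᵥ x ≤ n}.Finite := by
  have := hS.to_subtype
  refine ((List.finite_length_le S n.toNat).image fun l => (l.map Subtype.val).sum).subset ?_
  rintro x ⟨hx, hn⟩
  obtain ⟨l, hl, rfl⟩ := AddSubmonoid.exists_list_of_mem_closure hx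
  lift l to List S using hl
  refine ⟨l, ?_, rfl⟩
  -- An integral positive value is at least `1`, so the level bounds the number of summands.
  have key : ∀ l : List S, (l.length : ℤ) ≤ h ⬝ᵥ (l.map Subtype.val).sum := by
    intro l
    induction l with
    | nil => simp
    | cons a l ih =>
      have := hpos a a.2
      simp only [List.length_cons, List.map_cons, List.sum_cons, dotProduct_add]
      push_cast
      omega
  have := key l
  simp only [Set.mem_ofPred_eq]
  omega

theorem exists_add_of_mem_closure {S : Set (Pt d)} {x : Pt d} (hx : x ∈ semigp S) (h0 : x ≠ 0) :
    ∃ s ∈ S, ∃ y ∈ semigp S, x = s + y := by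
  obtain ⟨l, hl, rfl⟩ := AddSubmonoid.exists_list_of_mem_closure hx
  cases l with
  | nil => simp at h0
  | cons a l =>
    refine ⟨a, hl a (by simp), l.sum, list_sum_mem fun y hy => ?_, by simp⟩
    exact AddSubmonoid.subset_closure (hl y (by simp [hy]))

/-- The two base points differ by elements of `ℕA` with sum zero, so pointedness makes them equal; a
face is recovered from its semigroup by its cone. Maximality by inclusion therefore determines a
pair uniquely. -/
theorem pairSet_injOn {A : Set (Pt d)} {h : Pt d} (hh : CutsOut A ∅ h) {p q : Pt d × Set (Pt d)}
    (hp : IsFace A p.2) (hq : IsFace A q.2) (hpq : pairSet p = pairSet q) : p = q := by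
  obtain ⟨b, F⟩ := p
  obtain ⟨c, G⟩ := q
  have hF : semigp F ≤ semigp A := AddSubmonoid.closure_mono hp.subset
  have hG : semigp G ≤ semigp A := AddSubmonoid.closure_mono hq.subset
  obtain ⟨f, hf, hbf⟩ : b ∈ pairSet (c, G) := hpq ▸ ⟨0, zero_mem _, by simp⟩
  obtain ⟨g, hg, hcg⟩ : c ∈ pairSet (b, F) := hpq.symm ▸ ⟨0, zero_mem _, by simp⟩
  dsimp only at hbf hcg
  have h0 : f + g = 0 := by
    rw [hcg, add_assoc, left_eq_add, add_comm] at hbf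
    exact hbf
  have := hh.eq_zero_of_add_eq_zero (hG hf) (hF hg) h0
  have hbc : b = c := by rw [hbf, this, add_zero]
  subst hbc
  have key : ∀ {F G : Set (Pt d)}, IsFace A F → IsFace A G →
      pairSet (b, F) = pairSet (b, G) → F ⊆ G := by
    intro F G hF hG hFG x hx
    obtain ⟨y, hy, hxy⟩ : b + x ∈ pairSet (b, G) :=
      hFG ▸ ⟨x, AddSubmonoid.subset_closure hx, rfl⟩
    obtain rfl : x = y := add_left_cancel hxy
    exact hG.mem_of_mem_cone _ (hF.subset hx) (toReal_mem_realCone hy)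
  exact congrArg (Prod.mk b) (Set.Subset.antisymm (key hp hq hpq) (key hq hp hpq.symm))

/-! Monomial ideals. -/

section Monomial

variable {k : Type*} [Field k] {A : Set (Pt d)}

theorem mem_span_mono {S : Set (semigp A)} {x : SemigpRing k A} :
    x ∈ Ideal.span (mono k A '' S) ↔ ∀ m ∈ x.coeff.support, ∃ s ∈ S, ∃ t, m = t + s :=
  AddMonoidAlgebra.mem_ideal_span_of'_image

theorem support_mono (a : semigp A) : (mono k A a).coeff.support = {a} := by
  rw [mono, AddMonoidAlgebra.coeff_single, Finsupp.support_single _ one_ne_zero]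

theorem mono_mem_span {S : Set (semigp A)} {a : semigp A} :
    mono k A a ∈ Ideal.span (mono k A '' S) ↔ ∃ s ∈ S, ∃ t, a = t + s := by
  rw [mem_span_mono, support_mono]
  simp

theorem mem_stdMono_iff {I : Ideal (SemigpRing k A)} {a : semigp A} :
    (a : Pt d) ∈ stdMono I ↔ mono k A a ∉ I := by
  constructor
  · rintro ⟨b, hb, h⟩
    rwa [← Subtype.ext hb]
  · exact fun h => ⟨a, rfl, h⟩

theorem stdMono_subset {I : Ideal (SemigpRing k A)} : stdMono I ⊆ semigp A := by
  rintro x ⟨a, rfl, -⟩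
  exact a.2

theorem mem_of_add_mem_stdMono {I : Ideal (SemigpRing k A)} {x y : Pt d} (hx : x ∈ semigp A)
    (hy : y ∈ semigp A) (h : x + y ∈ stdMono I) : x ∈ stdMono I := by
  have h' := mem_stdMono_iff.1 (show ((⟨x, hx⟩ + ⟨y, hy⟩ : semigp A) : Pt d) ∈ stdMono I from h)
  refine (mem_stdMono_iff (a := ⟨x, hx⟩)).2 fun hmem => h' ?_
  have : mono k A (⟨x, hx⟩ + ⟨y, hy⟩) = mono k A ⟨y, hy⟩ * mono k A ⟨x, hx⟩ := by
    rw [mono, mono, mono, AddMonoidAlgebra.single_mul_single, one_mul, add_comm]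
  rw [this]
  exact Ideal.mul_mem_left _ _ hmem

/-- Reduces equality and intersection of monomial ideals to set algebra on exponents. -/
theorem IsMonomialIdeal.mem_iff {I : Ideal (SemigpRing k A)} (hI : IsMonomialIdeal I)
    {x : SemigpRing k A} : x ∈ I ↔ ∀ m ∈ x.coeff.support, (m : Pt d) ∉ stdMono I := by
  obtain ⟨S, rfl⟩ := hI
  simp only [mem_stdMono_iff, not_not, mono_mem_span]
  exact mem_span_mono

end Monomial

/-! The irreducible monomial ideal of a pair. -/

/-- The elements `b ∈ ℕA` with `a - b ∈ ℕA - ℕF`. -/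
def irrStd (A F : Set (Pt d)) (a : Pt d) : Set (Pt d) :=
  {b | b ∈ semigp A ∧ a - b ∈ loc A F}

/-- The monomial ideal with standard monomials `irrStd A F a`. -/
noncomputable def irrIdeal (k : Type*) [Field k] (A F : Set (Pt d)) (a : Pt d) :
    Ideal (SemigpRing k A) :=
  Ideal.span (mono k A '' {b | (b : Pt d) ∉ irrStd A F a})

theorem mem_irrStd_of_add_mem {A F : Set (Pt d)} {a x y : Pt d} (hx : x ∈ semigp A)
    (hy : y ∈ semigp A) (h : x + y ∈ irrStd A F a) : x ∈ irrStd A F a := by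
  refine ⟨hx, ?_⟩
  have := add_mem h.2 (mem_loc_of_mem_semigp (F := F) hy)
  rwa [sub_add_eq_sub_sub, sub_add_cancel] at this

theorem add_mem_irrStd {A F : Set (Pt d)} (hF : F ⊆ A) {a x f : Pt d} (hx : x ∈ irrStd A F a)
    (hf : f ∈ semigp F) : x + f ∈ irrStd A F a := by
  refine ⟨add_mem hx.1 (AddSubmonoid.closure_mono hF hf), ?_⟩
  rw [sub_add_eq_sub_sub, sub_eq_add_neg]
  exact add_mem hx.2 (neg_mem_loc hf)

theorem self_mem_irrStd {A F : Set (Pt d)} {a : Pt d} (ha : a ∈ semigp A) : a ∈ irrStd A F a :=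
  ⟨ha, by rw [sub_self]; exact zero_mem _⟩

theorem irrStd_subset {A F G : Set (Pt d)} {a b : Pt d} (hFG : F ⊆ G) (hab : b - a ∈ loc A G) :
    irrStd A F a ⊆ irrStd A G b := by
  rintro x ⟨hx, hax⟩
  refine ⟨hx, ?_⟩
  have := add_mem hab (loc_mono hFG hax)
  rwa [sub_add_sub_cancel] at this

section IrrIdeal

variable {k : Type*} [Field k] {A F : Set (Pt d)} {a : Pt d}

theorem irrIdeal_isMonomial : IsMonomialIdeal (irrIdeal k A F a) := ⟨_, rfl⟩

theorem stdMono_irrIdeal : stdMono (irrIdeal k A F a) = irrStd A F a := by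
  ext x
  constructor
  · rintro ⟨b, rfl, hb⟩
    by_contra hbs
    exact hb (Ideal.subset_span ⟨b, hbs, rfl⟩)
  · intro hx
    refine ⟨⟨x, hx.1⟩, rfl, fun h => ?_⟩
    obtain ⟨s, hs, t, hst⟩ := mono_mem_span.1 h
    refine hs (mem_irrStd_of_add_mem s.2 t.2 (y := (t : Pt d)) ?_)
    have : x = t + s := congrArg Subtype.val hst
    rwa [add_comm, ← this]

theorem mem_irrIdeal {x : SemigpRing k A} :
    x ∈ irrIdeal k A F a ↔ ∀ m ∈ x.coeff.support, (m : Pt d) ∉ irrStd A F a := by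
  rw [irrIdeal_isMonomial.mem_iff, stdMono_irrIdeal]

/-- `y` is the normal form of `x` modulo the ideal: nonstandard terms are dropped. -/
theorem exists_filter_sub_mem (x : SemigpRing k A) :
    ∃ y : SemigpRing k A, x - y ∈ irrIdeal k A F a ∧
      (∀ m ∈ y.coeff.support, (m : Pt d) ∈ irrStd A F a) ∧
      ∀ m : semigp A, (m : Pt d) ∈ irrStd A F a → y.coeff m = x.coeff m := by
  classical
  refine ⟨.ofCoeff (x.coeff.filter fun m => (m : Pt d) ∈ irrStd A F a), ?_, ?_, ?_⟩
  · rw [mem_irrIdeal]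
    intro m hm hmem
    rw [Finsupp.mem_support_iff] at hm
    refine hm ?_
    rw [AddMonoidAlgebra.coeff_sub, Finsupp.sub_apply, sub_eq_zero]
    exact (Finsupp.filter_apply_pos (fun m : semigp A => (m : Pt d) ∈ irrStd A F a) _ hmem).symm
  · intro m hm
    rw [AddMonoidAlgebra.coeff_ofCoeff, Finsupp.support_filter, Finset.mem_filter] at hm
    exact hm.2
  · intro m hm
    exact Finsupp.filter_apply_pos (fun m : semigp A => (m : Pt d) ∈ irrStd A F a) _ hm

end IrrIdeal

end StdPairs

/-! ### Irreducibility of the ideal of a pair. -/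

namespace StdPairs

variable {d : ℕ}

instance noZeroDivisors_semigp (k : Type*) [Field k] (S : AddSubmonoid (Pt d)) :
    NoZeroDivisors (AddMonoidAlgebra k S) := by
  have : UniqueSums S := UniqueSums.of_injective_addHom (H := S) (G := Pt d)
    (S.subtype : S →ₙ+ Pt d) Subtype.val_injective inferInstance
  infer_instance

section Irreducible

variable {k : Type*} [Field k] {A F : Set (Pt d)} {a ℓ : Pt d}

theorem support_mono_mul (m : semigp A) (x : SemigpRing k A) (c : semigp A) :
    c ∈ (mono k A m * x).coeff.support ↔ ∃ b ∈ x.coeff.support, m + b = c := by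
  rw [mono, AddMonoidAlgebra.support_coeff_single_mul _ _ (by simp)]
  simp

/-- The inclusion `k[ℕF] → k[ℕA]`. -/
noncomputable def inclRing (k : Type*) [Field k] (h : F ⊆ A) : SemigpRing k F →+* SemigpRing k A :=
  AddMonoidAlgebra.mapDomainRingHom k (AddSubmonoid.inclusion (AddSubmonoid.closure_mono h))

theorem inclRing_single (h : F ⊆ A) (v : semigp F) (r : k) :
    inclRing k h (AddMonoidAlgebra.single v r) =
      AddMonoidAlgebra.single (AddSubmonoid.inclusion (AddSubmonoid.closure_mono h) v) r :=
  AddMonoidAlgebra.mapDomain_single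

theorem exists_mono_mul_inclRing (h : F ⊆ A) (a : semigp A) (x : SemigpRing k A)
    (hx : ∀ m ∈ x.coeff.support, ∃ v ∈ semigp F, (m : Pt d) = a + v) :
    ∃ g : SemigpRing k F, mono k A a * inclRing k h g = x := by
  choose! v hv hmv using hx
  refine ⟨∑ m ∈ x.coeff.support.attach,
    AddMonoidAlgebra.single ⟨v m, hv m m.2⟩ (x.coeff m), ?_⟩
  conv_rhs => rw [← AddMonoidAlgebra.sum_coeff_single x, Finsupp.sum, ← Finset.sum_attach]
  rw [map_sum, Finset.mul_sum]
  refine Finset.sum_congr rfl fun m _ => ?_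
  rw [inclRing_single, mono, AddMonoidAlgebra.single_mul_single, one_mul]
  congr 1
  exact Subtype.ext (hmv m m.2).symm

theorem support_mono_mul_inclRing (h : F ⊆ A) (a : semigp A) (g : SemigpRing k F) (c : semigp A) :
    c ∈ (mono k A a * inclRing k h g).coeff.support ↔
      ∃ v ∈ g.coeff.support, (a : Pt d) + v = c := by
  classical
  have hinj : Function.Injective (AddSubmonoid.inclusion (AddSubmonoid.closure_mono h)) :=
    AddSubmonoid.inclusion_injective _
  have hs : (inclRing k h g).coeff.support =
      g.coeff.support.image (AddSubmonoid.inclusion (AddSubmonoid.closure_mono h)) :=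
    Finsupp.mapDomain_support_of_injective hinj g.coeff
  rw [support_mono_mul, hs]
  simp only [Finset.mem_image]
  constructor
  · rintro ⟨_, ⟨v, hv, rfl⟩, hc⟩
    exact ⟨v, hv, congrArg Subtype.val hc⟩
  · rintro ⟨v, hv, hc⟩
    exact ⟨_, ⟨v, hv, rfl⟩, Subtype.ext hc⟩

/-- Every ideal that is not contained in the ideal of the pair `(a, F)` meets `t^a k[ℕF]`, provided
that it contains the ideal of the pair. -/
theorem CutsOut.exists_mono_mul_mem (h : CutsOut A F ℓ) (a : semigp A)
    {J : Ideal (SemigpRing k A)} (hJ : irrIdeal k A F a ≤ J) (hne : ¬ J ≤ irrIdeal k A F a) :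
    ∃ g : SemigpRing k F, g ≠ 0 ∧ mono k A a * inclRing k h.subset g ∈ J := by
  classical
  obtain ⟨x, hxJ, hx⟩ := SetLike.not_le_iff_exists.1 hne
  obtain ⟨y, hxy, hys, -⟩ := exists_filter_sub_mem (F := F) (a := (a : Pt d)) x
  have hyJ : y ∈ J := by
    have := sub_mem hxJ (hJ hxy)
    rwa [sub_sub_cancel] at this
  have hy0 : y.coeff.support.Nonempty := by
    rw [Finsupp.support_nonempty_iff]
    intro h0
    have : y = 0 := AddMonoidAlgebra.coeff_eq_zero.1 h0
    rw [this, sub_zero] at hxy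
    exact hx hxy
  -- Take an exponent `b` of least `ℓ`-value and multiply by `t^m`, `m = a - b + f`, to move it to
  -- `a + f`. By minimality every other exponent `c` has `ℓ ⬝ᵥ (a - c) ≤ 0`, so after reduction all
  -- exponents differ from `a` by elements of the group of `F`.
  obtain ⟨b, hb, hmin⟩ := Finset.exists_min_image _ (fun b : semigp A => ℓ ⬝ᵥ (b : Pt d)) hy0
  obtain ⟨f, hf, hm⟩ := (hys b hb).2
  obtain ⟨m, hmv⟩ : ∃ m : semigp A, (m : Pt d) = a - b + f := ⟨⟨_, hm⟩, rfl⟩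
  have hzJ : mono k A m * y ∈ J := J.mul_mem_left _ hyJ
  obtain ⟨w, hzw, hws, hwc⟩ := exists_filter_sub_mem (F := F) (a := (a : Pt d)) (mono k A m * y)
  have hwJ : w ∈ J := by
    have := sub_mem hzJ (hJ hzw)
    rwa [sub_sub_cancel] at this
  have hmb : ((m + b : semigp A) : Pt d) = a + f := by
    rw [AddSubmonoid.coe_add, hmv]
    abel
  have hw0 : m + b ∈ w.coeff.support := by
    rw [Finsupp.mem_support_iff, hwc, ← Finsupp.mem_support_iff, support_mono_mul]
    · exact ⟨b, hb, rfl⟩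
    · rw [hmb]
      exact add_mem_irrStd h.subset (self_mem_irrStd a.2) hf
  have hF : ∀ c ∈ w.coeff.support, ∃ u : semigp F, ∃ v ∈ semigp F, (c : Pt d) + u = a + v := by
    intro c hc
    have hcs := hws c hc
    rw [Finsupp.mem_support_iff, hwc c hcs, ← Finsupp.mem_support_iff, support_mono_mul] at hc
    obtain ⟨b', hb', rfl⟩ := hc
    obtain ⟨v, hv, u, hu, huv⟩ := h.exists_add_eq_of_mem_loc hcs.2 (by
      have h1 := hmin b' hb'
      rw [dotProduct_sub, AddSubmonoid.coe_add, dotProduct_add, hmv, dotProduct_add,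
        dotProduct_sub, h.dot_eq_zero hf]
      linarith)
    refine ⟨⟨u, hu⟩, v, hv, ?_⟩
    simp only [← huv]
    abel
  choose! u v hv huv using hF
  -- A common denominator: multiplying by `t^U` moves every exponent into `a + ℕF`.
  let U : semigp F := ∑ c ∈ w.coeff.support, u c
  let U' : semigp A := AddSubmonoid.inclusion (AddSubmonoid.closure_mono h.subset) U
  obtain ⟨g, hg⟩ := exists_mono_mul_inclRing h.subset a (mono k A U' * w) (by
    intro c hc
    obtain ⟨b', hb', rfl⟩ := (support_mono_mul _ _ _).1 hc
    refine ⟨v b' + (∑ c ∈ w.coeff.support.erase b', u c : semigp F),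
      add_mem (hv b' hb') (SetLike.coe_mem _), ?_⟩
    have hU : (U' : Pt d) = u b' + (∑ c ∈ w.coeff.support.erase b', u c : semigp F) := by
      change (U : Pt d) = _
      rw [← AddSubmonoid.coe_add, Finset.add_sum_erase _ _ hb']
    rw [AddSubmonoid.coe_add, hU, ← add_assoc, ← huv b' hb']
    abel)
  refine ⟨g, ?_, hg ▸ J.mul_mem_left _ hwJ⟩
  rintro rfl
  have : U' + (m + b) ∈ (mono k A U' * w).coeff.support :=
    (support_mono_mul _ _ _).2 ⟨_, hw0, rfl⟩
  rw [← hg] at this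
  simp at this

/-- The monomial ideal of a pair is irreducible. -/
theorem CutsOut.infIrred_irrIdeal (h : CutsOut A F ℓ) {a : Pt d} (ha : a ∈ semigp A) :
    InfIrred (irrIdeal k A F a) := by
  have hmul : ∀ g : SemigpRing k F, g ≠ 0 →
      mono k A ⟨a, ha⟩ * inclRing k h.subset g ∉ irrIdeal k A F a := by
    intro g hg hmem
    obtain ⟨v, hv⟩ := Finsupp.support_nonempty_iff.2 fun h0 => hg (AddMonoidAlgebra.coeff_eq_zero.1 h0)
    have hav := add_mem_irrStd h.subset (self_mem_irrStd (F := F) ha) v.2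
    exact mem_irrIdeal.1 hmem ⟨a + v, hav.1⟩
      ((support_mono_mul_inclRing _ _ _ _).2 ⟨v, hv, rfl⟩) hav
  refine ⟨fun hmax => ?_, fun J K hJK => ?_⟩
  · have : irrIdeal k A F a = ⊤ := isMax_iff_eq_top.1 hmax
    exact hmul 1 one_ne_zero (this ▸ Submodule.mem_top)
  · by_contra hcon
    push Not at hcon
    obtain ⟨g, hg, hgJ⟩ := h.exists_mono_mul_mem ⟨a, ha⟩ (J := J) (hJK ▸ inf_le_left)
      fun hle => hcon.1 (le_antisymm hle (hJK ▸ inf_le_left))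
    obtain ⟨g', hg', hgK⟩ := h.exists_mono_mul_mem ⟨a, ha⟩ (J := K) (hJK ▸ inf_le_right)
      fun hle => hcon.2 (le_antisymm hle (hJK ▸ inf_le_right))
    -- `t^a g g'` lies in both `J` and `K`, but cannot lie in their intersection since `g g' ≠ 0`.
    refine hmul (g * g') (mul_ne_zero hg hg') ?_
    rw [← hJK, map_mul]
    constructor
    · rw [← mul_assoc]
      exact J.mul_mem_right _ hgJ
    · rw [mul_left_comm]
      exact K.mul_mem_left _ hgK

end Irreducible

end StdPairs

/-! ### Standard pairs and irredundant decompositions. -/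

namespace StdPairs

variable {d : ℕ} {k : Type*} [Field k] {A : Set (Pt d)}

/-- Along the ray in direction `g`, the value of `ℓ` at `a - c - n g` must stay nonnegative; if `ℓ`
is positive on `g`, this fails as soon as `n` exceeds its value at `a - c`. -/
theorem CutsOut.face_subset {F G : Set (Pt d)} {a c ℓ : Pt d} (h : CutsOut A F ℓ) (hG : G ⊆ A)
    (hc : ∀ g ∈ G, ∀ n : ℕ, c + n • g ∈ irrStd A F a) : G ⊆ F := by
  intro g hg
  by_contra hgF
  have hpos := h.pos g (hG hg) hgF
  have hn := h.nonneg_of_mem_loc (hc g hg ((ℓ ⬝ᵥ (a - c)).toNat + 1)).2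
  rw [← sub_sub, dotProduct_sub, dotProduct_smul, nsmul_eq_mul] at hn
  push_cast at hn
  have := Int.self_le_toNat (ℓ ⬝ᵥ (a - c))
  nlinarith

/-- A finite set of points presents the standard pairs of the ideal of a pair. -/
theorem CutsOut.stdPairs_irrIdeal {F : Set (Pt d)} {a ℓ h : Pt d} (hℓ : CutsOut A F ℓ)
    (hh : CutsOut A ∅ h) (hF : IsFace A F) {B : Set (Pt d)} (hB : B ⊆ irrStd A F a)
    (hcov : ∀ x ∈ irrStd A F a, ∃ b ∈ B, x - b ∈ semigp F)
    (hmin : ∀ b ∈ B, ∀ b' ∈ B, b - b' ∈ semigp F → b = b') :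
    stdPairs (irrIdeal k A F a) = (fun b => (b, F)) '' B := by
  have hprop : ∀ b ∈ B, IsProperPair (irrIdeal k A F a) (b, F) := by
    refine fun b hb => ⟨⟨(hB hb).1, hF⟩, ?_⟩
    rintro _ ⟨f, hf, rfl⟩
    rw [stdMono_irrIdeal]
    exact add_mem_irrStd hF.subset (hB hb) hf
  have hsub : ∀ q, IsProperPair (irrIdeal k A F a) q → q.1 ∈ irrStd A F a ∧ q.2 ⊆ F := by
    rintro ⟨c, G⟩ ⟨⟨hc, hG⟩, hq⟩
    rw [stdMono_irrIdeal] at hq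
    refine ⟨hq ⟨0, zero_mem _, by simp⟩, hℓ.face_subset (a := a) (c := c) hG.subset
      fun g hg n => ?_⟩
    exact hq ⟨_, nsmul_mem (AddSubmonoid.subset_closure hg) n, rfl⟩
  ext ⟨c, G⟩
  constructor
  · rintro ⟨hcG, hmax⟩
    obtain ⟨hc, hGF⟩ := hsub _ hcG
    obtain ⟨b, hb, hcb⟩ := hcov c hc
    refine ⟨b, hb, hmax (b, F) (hprop b hb) ?_⟩
    rintro _ ⟨g, hg, rfl⟩
    refine ⟨_, add_mem hcb (AddSubmonoid.closure_mono hGF hg), ?_⟩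
    dsimp only
    abel
  · rintro ⟨b, hb, hbc⟩
    obtain ⟨rfl, rfl⟩ := Prod.mk.inj hbc
    refine ⟨hprop b hb, ?_⟩
    rintro ⟨c, G⟩ hcG hle
    obtain ⟨hc, hGF⟩ := hsub _ hcG
    dsimp only at hc hGF
    obtain ⟨g, hg, hbg⟩ := hle (show b ∈ pairSet (b, F) from ⟨0, zero_mem _, by simp⟩)
    dsimp only at hg hbg
    obtain ⟨b', hb', hcb⟩ := hcov c hc
    have hgF := AddSubmonoid.closure_mono hGF hg
    -- The base point `c` lies over some `b' ∈ B`, and then so does `b`; separation gives `b' = b`.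
    -- Thus `b` and `c` each exceed the other by an element of `ℕF`, and pointedness identifies
    -- them.
    obtain rfl : b = b' := hmin b hb b' hb' (by
      have := add_mem hcb hgF
      rwa [sub_add_eq_add_sub, ← hbg] at this)
    have hg0 : g = 0 := hh.eq_zero_of_add_eq_zero (AddSubmonoid.closure_mono hF.subset hgF)
      (AddSubmonoid.closure_mono hF.subset hcb) (by rw [hbg]; abel)
    rw [hg0, add_zero] at hbg
    subst hbg
    refine pairSet_injOn hh hcG.1.2 hF (Set.Subset.antisymm ?_ hle)
    rintro _ ⟨g, hg, rfl⟩
    exact ⟨g, AddSubmonoid.closure_mono hGF hg, rfl⟩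

/-- Points of `ℕA` are covered by `B + ℕF` and `G + ℕA`, if `0` and the successors of points of
`B` are. -/
theorem cover_of_closed {F B G : Set (Pt d)} (h0 : 0 ∈ B)
    (hstep : ∀ b ∈ B, ∀ c ∈ A, (∃ b' ∈ B, b + c - b' ∈ semigp F) ∨ ∃ g ∈ G, b + c - g ∈ semigp A)
    (hFA : F ⊆ A) {x : Pt d} (hx : x ∈ semigp A) :
    (∃ b ∈ B, x - b ∈ semigp F) ∨ ∃ g ∈ G, x - g ∈ semigp A := by
  induction hx using AddSubmonoid.closure_induction_right with
  | zero => exact Or.inl ⟨0, h0, by simp⟩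
  | add_right x hx c hc ih =>
    rcases ih with ⟨b, hb, hxb⟩ | ⟨g, hg, hxg⟩
    · rcases hstep b hb c hc with ⟨b', hb', h⟩ | ⟨g, hg, h⟩
      · refine Or.inl ⟨b', hb', ?_⟩
        have := add_mem hxb h
        rwa [show x - b + (b + c - b') = x + c - b' by abel] at this
      · refine Or.inr ⟨g, hg, ?_⟩
        have := add_mem (AddSubmonoid.closure_mono hFA hxb) h
        rwa [show x - b + (b + c - g) = x + c - g by abel] at this
    · refine Or.inr ⟨g, hg, ?_⟩
      rw [← sub_add_eq_add_sub]
      exact add_mem hxg (AddSubmonoid.subset_closure hc)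

theorem irrIdeal_eq_span {F G : Set (Pt d)} {a : Pt d} (hG : ∀ g ∈ G, g ∈ semigp A)
    (hGs : ∀ g ∈ G, g ∉ irrStd A F a)
    (hcov : ∀ x ∈ semigp A, x ∈ irrStd A F a ∨ ∃ g ∈ G, x - g ∈ semigp A) :
    irrIdeal k A F a = Ideal.span (mono k A '' {g | (g : Pt d) ∈ G}) := by
  refine le_antisymm (Ideal.span_le.2 ?_) (Ideal.span_mono (Set.image_mono fun g hg => hGs g hg))
  rintro _ ⟨x, hx, rfl⟩
  obtain ⟨g, hg, hxg⟩ := (hcov x x.2).resolve_left hx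
  exact mono_mem_span.2 ⟨⟨g, hG g hg⟩, hg, ⟨_, hxg⟩, Subtype.ext (by simp)⟩

/-- Standard monomials are covered by the standard pairs. -/
theorem exists_mem_stdPairs (hA : A.Finite) {h : Pt d} (hh : CutsOut A ∅ h)
    (hface : IsFace A ∅) {I : Ideal (SemigpRing k A)} {x : Pt d} (hx : x ∈ stdMono I) :
    ∃ p ∈ stdPairs I, x ∈ pairSet p := by
  let T : Set (Pt d × Set (Pt d)) := {p | IsProperPair I p ∧ x ∈ pairSet p}
  -- The grading bounds the base points of pairs through `x`, and faces are subsets of a finite set,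
  -- so a maximal pair through `x` exists.
  have hfin : T.Finite := by
    refine ((finite_semigp_le hA (fun a ha => hh.pos a ha (by simp)) (h ⬝ᵥ x)).prod
      hA.finite_subsets).subset ?_
    rintro ⟨b, G⟩ ⟨⟨⟨hb, hG⟩, -⟩, g, hg, rfl⟩
    refine ⟨⟨hb, ?_⟩, hG.subset⟩
    have := hh.nonneg (AddSubmonoid.closure_mono hG.subset hg)
    dsimp only
    rw [dotProduct_add]
    linarith
  have hne : T.Nonempty := by
    refine ⟨(x, ∅), ⟨⟨stdMono_subset hx, hface⟩, ?_⟩, 0, zero_mem _, by simp⟩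
    rintro _ ⟨f, hf, rfl⟩
    have : f = 0 := by simpa [semigp] using hf
    simpa [this] using hx
  obtain ⟨p, hp, hmax⟩ := hfin.exists_maximalFor pairSet T hne
  refine ⟨p, ⟨hp.1, fun q hq hpq => ?_⟩, hp.2⟩
  exact pairSet_injOn hh hq.1.2 hp.1.1.2
    (Set.Subset.antisymm (hmax ⟨hq, hpq hp.2⟩ hpq) hpq)

/-- Such a `t^b` divides a monomial in `p.1 + ℕF`, which is standard. -/
theorem irrStd_subset_stdMono {I : Ideal (SemigpRing k A)} {p : Pt d × Set (Pt d)}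
    (hp : IsProperPair I p) : irrStd A p.2 p.1 ⊆ stdMono I := by
  rintro b ⟨hb, f, hf, hm⟩
  refine mem_of_add_mem_stdMono hb hm ?_
  rw [show b + (p.1 - b + f) = p.1 + f by abel]
  exact hp.2 ⟨f, hf, rfl⟩

theorem pairSet_subset_irrStd {p : Pt d × Set (Pt d)} (hp : IsPair A p) :
    pairSet p ⊆ irrStd A p.2 p.1 := by
  rintro _ ⟨f, hf, rfl⟩
  exact add_mem_irrStd hp.2.subset (self_mem_irrStd hp.1) hf

/-- The preorder on pairs by containment of the sets `irrStd`. -/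
def PairLE (A : Set (Pt d)) (p q : Pt d × Set (Pt d)) : Prop :=
  p.2 ⊆ q.2 ∧ q.1 - p.1 ∈ loc A q.2

theorem PairLE.refl (p : Pt d × Set (Pt d)) : PairLE A p p :=
  ⟨subset_rfl, by rw [sub_self]; exact zero_mem _⟩

theorem PairLE.trans {p q r : Pt d × Set (Pt d)} (h : PairLE A p q) (h' : PairLE A q r) :
    PairLE A p r := by
  refine ⟨h.1.trans h'.1, ?_⟩
  rw [← sub_add_sub_cancel r.1 q.1 p.1]
  exact add_mem h'.2 (loc_mono h'.1 h.2)

/-- Follow the ray from `a` in the direction `s`, the sum of `F`. One of the finitely many sets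
contains infinitely many of its lattice points, hence all of them by closure under divisors. Since
`s` involves every element of `F`, `face_subset` applies. -/
theorem exists_pairLE_of_subset_iUnion {ι : Type*} [Finite ι] {p : Pt d × Set (Pt d)}
    (hp : IsPair A p) (hfin : p.2.Finite) (q : ι → Pt d × Set (Pt d))
    (hq : ∀ i, ∃ ℓ, CutsOut A (q i).2 ℓ)
    (hsub : irrStd A p.2 p.1 ⊆ ⋃ i, irrStd A (q i).2 (q i).1) : ∃ i, PairLE A p (q i) := by
  classical
  obtain ⟨a, F⟩ := p
  dsimp only at hfin hsub
  have hFA : semigp F ≤ semigp A := AddSubmonoid.closure_mono hp.2.subset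
  let s : Pt d := ∑ f ∈ hfin.toFinset, f
  have hs : s ∈ semigp F := sum_mem fun f hf =>
    AddSubmonoid.subset_closure ((Set.Finite.mem_toFinset _).1 hf)
  have hmem : ∀ n : ℕ, ∃ i, a + n • s ∈ irrStd A (q i).2 (q i).1 := fun n =>
    Set.mem_iUnion.1 (hsub (add_mem_irrStd hp.2.subset (self_mem_irrStd hp.1) (nsmul_mem hs n)))
  choose i hi using hmem
  obtain ⟨j, hj⟩ := Finite.exists_infinite_fiber i
  have hinf : (i ⁻¹' {j}).Infinite := Set.infinite_coe_iff.1 hj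
  have hall : ∀ n : ℕ, a + n • s ∈ irrStd A (q j).2 (q j).1 := by
    intro n
    obtain ⟨m, hm, hnm⟩ := hinf.exists_gt n
    have hjm := hi m
    rw [show i m = j from hm] at hjm
    refine mem_irrStd_of_add_mem (y := (m - n) • s) (add_mem hp.1 (nsmul_mem (hFA hs) n))
      (nsmul_mem (hFA hs) _) ?_
    rwa [add_assoc, ← add_nsmul, Nat.add_sub_cancel' hnm.le]
  obtain ⟨ℓ, hℓ⟩ := hq j
  refine ⟨j, hℓ.face_subset (a := (q j).1) (c := a) hp.2.subset fun f hf n => ?_, ?_⟩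
  · refine mem_irrStd_of_add_mem (y := n • ∑ g ∈ hfin.toFinset.erase f, g)
      (add_mem hp.1 (nsmul_mem (AddSubmonoid.subset_closure (hp.2.subset hf)) n))
      (nsmul_mem (sum_mem fun g hg => AddSubmonoid.subset_closure (hp.2.subset
        ((Set.Finite.mem_toFinset _).1 (Finset.mem_of_mem_erase hg)))) n) ?_
    rw [add_assoc, ← nsmul_add, Finset.add_sum_erase _ (fun g : Pt d => g)
      ((Set.Finite.mem_toFinset _).2 hf)]
    exact hall n
  · have := (hall 0).2
    simpa using this

/-- A monomial ideal is the irredundant intersection of the ideals of representatives of the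
maximal classes of its standard pairs. -/
theorem isIrreducibleDecomposition_irrIdeal (hA : A.Finite) {h : Pt d} (hh : CutsOut A ∅ h)
    (hface : IsFace A ∅) {I : Ideal (SemigpRing k A)} (hI : IsMonomialIdeal I) {m : ℕ}
    (q : Fin m → Pt d × Set (Pt d)) (hq : ∀ i, q i ∈ stdPairs I)
    (hcov : ∀ p ∈ stdPairs I, ∃ i, PairLE A p (q i))
    (hirr : ∀ i j, i ≠ j → ¬ PairLE A (q i) (q j)) :
    IsIrreducibleDecomposition I fun i => irrIdeal k A (q i).2 (q i).1 := by
  have hstd : stdMono I = ⋃ i, irrStd A (q i).2 (q i).1 := by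
    refine Set.Subset.antisymm (fun x hx => ?_)
      (Set.iUnion_subset fun i => irrStd_subset_stdMono (hq i).1)
    obtain ⟨p, hp, hxp⟩ := exists_mem_stdPairs hA hh hface hx
    obtain ⟨i, hi⟩ := hcov p hp
    exact Set.mem_iUnion.2 ⟨i, irrStd_subset hi.1 hi.2 (pairSet_subset_irrStd hp.1.1 hxp)⟩
  have hcut : ∀ i, ∃ ℓ, CutsOut A (q i).2 ℓ := fun i => (hq i).1.1.2.exists_cutsOut hA
  refine ⟨fun i => (hcut i).choose_spec.infIrred_irrIdeal (hq i).1.1.1, ?_, fun i hi => ?_⟩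
  · ext x
    simp only [Ideal.mem_iInf, mem_irrIdeal, hI.mem_iff, hstd, Set.mem_iUnion, not_exists]
    exact ⟨fun H m hm i => H i m hm, fun H i m hm => H m hm i⟩
  · obtain ⟨j, hj⟩ := exists_pairLE_of_subset_iUnion (ι := {j // j ≠ i}) (hq i).1.1
      (hA.subset (hq i).1.1.2.subset) (fun j => q j) (fun j => hcut j) (by
      intro x hx
      by_contra hcon
      simp only [Set.mem_iUnion, not_exists] at hcon
      -- A standard point of component `i` missed by all the others would give a monomial in the
      -- remaining intersection, hence in `I`, although it is standard for `I`.
      have hmem : mono k A ⟨x, hx.1⟩ ∈ I := by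
        rw [← hi]
        simp only [Ideal.mem_iInf, mem_irrIdeal, support_mono, Finset.mem_singleton]
        exact fun j hj _ hm => hm ▸ hcon ⟨j, hj⟩
      refine (mem_stdMono_iff (a := ⟨x, hx.1⟩)).1 ?_ hmem
      rw [hstd]
      exact Set.mem_iUnion.2 ⟨i, hx⟩)
    exact hirr i j j.2.symm hj

end StdPairs

namespace StdPairs

variable {d : ℕ}

/-! Certificates. -/

/-- A certificate for `x ∉ ℕA - ℕF`. -/
def NegCert (A F : Set (Pt d)) (x : Pt d) : Prop :=
  ∃ (ℓ : Pt d) (Z : List (Pt d)), x ∈ Z ∧ (∀ a ∈ A, 0 ≤ ℓ ⬝ᵥ a) ∧ (∀ f ∈ F, ℓ ⬝ᵥ f = 0) ∧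
    (∀ z ∈ Z, ∀ a ∈ A, a ∈ F ∨ z - a ∈ Z ∨ ℓ ⬝ᵥ z < ℓ ⬝ᵥ a) ∧
    ∀ z ∈ Z, ∃ (y : Pt d) (q : ℤ), (∀ f ∈ F, ∃ c, y ⬝ᵥ f = q * c) ∧
      ∃ c r, y ⬝ᵥ z = q * c + r ∧ 0 < r ∧ r < q

/-- Suppose `x + f` is a sum of elements of `A` and remove the summands one by one. Those in `F` are
absorbed by the lattice, the others stay inside `Z` or are excluded by the size of `ℓ`. At the end a
point of `Z` lies in the lattice of `F`, against its congruence. -/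
theorem NegCert.notMem_loc {A F : Set (Pt d)} {x : Pt d} (h : NegCert A F x) :
    x ∉ loc A F := by
  obtain ⟨ℓ, Z, hxZ, hA, hF, hstep, hsep⟩ := h
  have hlat : ∀ v ∈ AddSubgroup.closure F, ℓ ⬝ᵥ v = 0 := by
    intro v hv
    induction hv using AddSubgroup.closure_induction with
    | mem v hv => exact hF v hv
    | zero => simp
    | add u v _ _ hu hv => rw [dotProduct_add, hu, hv, add_zero]
    | neg v _ hv => rw [dotProduct_neg, hv, neg_zero]
  have key : ∀ l : List (Pt d), (∀ y ∈ l, y ∈ A) → ∀ z ∈ Z, ∀ v ∈ AddSubgroup.closure F,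
      z + v ≠ l.sum := by
    intro l
    induction l with
    | nil =>
      intro _ z hz v hv hzv
      obtain ⟨y, q, hy, c, r, hr, hr0, hrq⟩ := hsep z hz
      have hdvd : ∀ v ∈ AddSubgroup.closure F, q ∣ y ⬝ᵥ v := by
        intro v hv
        induction hv using AddSubgroup.closure_induction with
        | mem v hv => exact (hy v hv).imp fun _ h => h
        | zero => simp
        | add u v _ _ hu hv => rw [dotProduct_add]; exact dvd_add hu hv
        | neg v _ hv => rw [dotProduct_neg]; exact (dvd_neg).2 hv
      have hz : y ⬝ᵥ z + y ⬝ᵥ v = 0 := by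
        rw [← dotProduct_add, hzv, List.sum_nil, dotProduct_zero]
      have : q ∣ r := by
        obtain ⟨e, he⟩ := hdvd v hv
        refine ⟨-c - e, ?_⟩
        rw [mul_sub, mul_neg]
        linarith
      exact absurd (Int.le_of_dvd hr0 this) (not_le.2 hrq)
    | cons a l ih =>
      intro hl z hz v hv hzv
      rw [List.sum_cons] at hzv
      have hl' : ∀ y ∈ l, y ∈ A := fun y hy => hl y (by simp [hy])
      rcases hstep z hz a (hl a (by simp)) with haF | haZ | hlt
      · refine ih hl' z hz (v - a) (sub_mem hv (AddSubgroup.subset_closure haF)) ?_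
        rw [← add_sub_assoc, hzv, add_sub_cancel_left]
      · refine ih hl' (z - a) haZ v hv ?_
        rw [sub_add_eq_add_sub, hzv, add_sub_cancel_left]
      · have h1 : ℓ ⬝ᵥ z + ℓ ⬝ᵥ v = ℓ ⬝ᵥ a + ℓ ⬝ᵥ l.sum := by
          rw [← dotProduct_add, hzv, dotProduct_add]
        have h2 : 0 ≤ ℓ ⬝ᵥ l.sum := by
          clear ih hzv hl h1
          induction l with
          | nil => simp
          | cons b l ih =>
            rw [List.sum_cons, dotProduct_add]
            exact add_nonneg (hA b (hl' b (by simp))) (ih fun y hy => hl' y (by simp [hy]))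
        rw [hlat v hv] at h1
        linarith
  rintro ⟨f, hf, hxf⟩
  obtain ⟨l, hl, hsum⟩ := AddSubmonoid.exists_list_of_mem_closure hxf
  refine key l hl x hxZ f ?_ hsum.symm
  exact (AddSubmonoid.closure_le (S := (AddSubgroup.closure F).toAddSubmonoid)).2
    AddSubgroup.subset_closure hf

theorem exists_add_mem_of_mem_addSubgroup_closure {F : Set (Pt d)} {v : Pt d}
    (hv : v ∈ AddSubgroup.closure F) : ∃ f ∈ semigp F, v + f ∈ semigp F := by
  induction hv using AddSubgroup.closure_induction with
  | mem v hv => exact ⟨0, zero_mem _, by simpa using AddSubmonoid.subset_closure hv⟩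
  | zero => exact ⟨0, zero_mem _, by simp⟩
  | add u v _ _ hu hv =>
    obtain ⟨f, hf, hu⟩ := hu
    obtain ⟨g, hg, hv⟩ := hv
    refine ⟨f + g, add_mem hf hg, ?_⟩
    rw [add_add_add_comm]
    exact add_mem hu hv
  | neg v _ hv =>
    obtain ⟨f, hf, hv⟩ := hv
    exact ⟨v + f, hv, by simpa using hf⟩

theorem CutsOut.negCert_iff {A F : Set (Pt d)} {ℓ : Pt d} (h : CutsOut A F ℓ) (hA : A.Finite)
    {x : Pt d} : NegCert A F x ↔ x ∉ loc A F := by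
  refine ⟨NegCert.notMem_loc, fun hx => ?_⟩
  -- All remainders of `x` after subtracting elements of `A` outside `F`, up to the level of `x`;
  -- this is finite as `ℓ` is positive there. `x` is inserted because the level set is empty when
  -- `ℓ` is negative at `x`.
  let T : Set (Pt d) := insert x ((fun s => x - s) '' {s | s ∈ semigp (A \ F) ∧ ℓ ⬝ᵥ s ≤ ℓ ⬝ᵥ x})
  have hT : T.Finite := ((finite_semigp_le (hA.subset Set.sdiff_subset)
    (fun a ha => h.pos a ha.1 ha.2) _).image _).insert _
  have hTx : ∀ z ∈ T, ∃ s ∈ semigp (A \ F), z = x - s := by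
    rintro z (rfl | ⟨s, hs, rfl⟩)
    · exact ⟨0, zero_mem _, by simp⟩
    · exact ⟨s, hs.1, rfl⟩
  refine ⟨ℓ, hT.toFinset.toList, by simp [T], fun a ha => h.nonneg_of_mem ha, h.eq_zero, ?_, ?_⟩
  · intro z hz a ha
    by_cases haF : a ∈ F
    · exact Or.inl haF
    by_cases hlt : ℓ ⬝ᵥ z < ℓ ⬝ᵥ a
    · exact Or.inr (Or.inr hlt)
    refine Or.inr (Or.inl ?_)
    rw [Finset.mem_toList, Set.Finite.mem_toFinset] at hz ⊢
    obtain ⟨s, hs, rfl⟩ := hTx z hz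
    refine Or.inr ⟨s + a, ⟨add_mem hs (AddSubmonoid.subset_closure ⟨ha, haF⟩), ?_⟩, ?_⟩
    · rw [dotProduct_sub] at hlt
      rw [dotProduct_add]
      linarith
    · dsimp only
      abel
  · intro z hz
    rw [Finset.mem_toList, Set.Finite.mem_toFinset] at hz
    obtain ⟨s, hs, rfl⟩ := hTx z hz
    have hnot : x - s ∉ AddSubgroup.closure F := by
      intro hmem
      obtain ⟨f, hf, hxf⟩ := exists_add_mem_of_mem_addSubgroup_closure hmem
      refine hx ⟨f, hf, ?_⟩
      rw [show x + f = s + (x - s + f) by abel]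
      exact add_mem (AddSubmonoid.closure_mono Set.sdiff_subset hs) (h.semigp_le hxf)
    obtain ⟨y, q, hq, hyF, hyz⟩ := exists_separating_congruence hnot
    refine ⟨y, q, fun f hf => hyF f hf, y ⬝ᵥ (x - s) / q, y ⬝ᵥ (x - s) % q,
      (Int.mul_ediv_add_emod _ _).symm, ?_, Int.emod_lt_of_pos _ hq⟩
    exact lt_of_le_of_ne (Int.emod_nonneg _ hq.ne') fun h0 =>
      hyz (Int.dvd_of_emod_eq_zero h0.symm)

/-- `B` consists of the points of the standard pairs of the ideal of `(a, F)`, and `G` generates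
that ideal. -/
structure IsComponent (A F : Set (Pt d)) (a : Pt d) (B G : Set (Pt d)) : Prop where
  zero_mem : 0 ∈ B
  std : ∀ b ∈ B, b ∈ semigp A ∧ a - b ∈ loc A F
  step : ∀ b ∈ B, ∀ c ∈ A,
    (∃ b' ∈ B, b + c - b' ∈ semigp F) ∨ ∃ g ∈ G, b + c - g ∈ semigp A
  gens : ∀ g ∈ G, g ∈ semigp A ∧ a - g ∉ loc A F
  sep : ∀ b ∈ B, ∀ b' ∈ B, b = b' ∨ b - b' ∉ semigp F

namespace IsComponent

variable {A F : Set (Pt d)} {a : Pt d} {B G : Set (Pt d)}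

/-- Starting from `0`, the closure conditions cover all of `ℕA` by `B + ℕF` and `G + ℕA`; a standard
point has no divisor in `G`, so it falls under `B`. -/
theorem stdPairs_eq (H : IsComponent A F a B G) (k : Type*) [Field k] {ℓ h : Pt d}
    (hℓ : CutsOut A F ℓ) (hh : CutsOut A ∅ h) (hF : IsFace A F) :
    stdPairs (irrIdeal k A F a) = (fun b => (b, F)) '' B := by
  refine hℓ.stdPairs_irrIdeal hh hF H.std (fun x hx => ?_)
    fun b hb b' hb' hbb => (H.sep b hb b' hb').resolve_right (not_not.2 hbb)
  refine (cover_of_closed H.zero_mem H.step hF.subset hx.1).resolve_right ?_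
  rintro ⟨g, hg, hxg⟩
  refine (H.gens g hg).2 (mem_irrStd_of_add_mem (H.gens g hg).1 hxg ?_).2
  rwa [add_sub_cancel]

theorem irrIdeal_eq (H : IsComponent A F a B G) (k : Type*) [Field k] (hF : F ⊆ A) :
    irrIdeal k A F a = Ideal.span (mono k A '' {g | (g : Pt d) ∈ G}) := by
  refine irrIdeal_eq_span (fun g hg => (H.gens g hg).1)
    (fun g hg hs => (H.gens g hg).2 hs.2) fun x hx => ?_
  refine (cover_of_closed H.zero_mem H.step hF hx).imp_left ?_
  rintro ⟨b, hb, hxb⟩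
  have := add_mem_irrStd hF (H.std b hb) hxb
  rwa [add_sub_cancel] at this

end IsComponent

theorem CutsOut.exists_isComponent {A F : Set (Pt d)} {ℓ h : Pt d} (hA : A.Finite)
    (hℓ : CutsOut A F ℓ) (hh : CutsOut A ∅ h) {a : Pt d} (ha : a ∈ semigp A) :
    ∃ B G : Set (Pt d), B.Finite ∧ G.Finite ∧ IsComponent A F a B G := by
  have hpos : ∀ f ∈ F, 0 < h ⬝ᵥ f := fun f hf => hh.pos f (hℓ.subset hf) (by simp)
  -- The standard points from which no element of `F` can be subtracted. They are sums of elements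
  -- outside `F` and `ℓ` is bounded on them by its value at `a`, hence they are finitely many.
  let B : Set (Pt d) := {b | b ∈ irrStd A F a ∧ ∀ f ∈ F, b - f ∉ semigp A}
  have hB : B.Finite := by
    refine (finite_semigp_le (hA.subset Set.sdiff_subset)
      (fun a ha => hℓ.pos a ha.1 ha.2) (ℓ ⬝ᵥ a)).subset ?_
    rintro b ⟨⟨hb, hab⟩, hbF⟩
    have hab := hℓ.nonneg_of_mem_loc hab
    rw [dotProduct_sub] at hab
    refine ⟨?_, by linarith⟩
    rw [← Set.union_sdiff_cancel hℓ.subset, semigp, AddSubmonoid.closure_union] at hb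
    obtain ⟨u, hu, v, hv, rfl⟩ := AddSubmonoid.mem_sup.1 hb
    have hu0 : u = 0 := by
      by_contra hne
      obtain ⟨f, hf, w, hw, rfl⟩ := exists_add_of_mem_closure hu hne
      refine hbF f hf ?_
      rw [show f + w + v - f = w + v by abel]
      exact add_mem (hℓ.semigp_le hw) (AddSubmonoid.closure_mono Set.sdiff_subset hv)
    simpa [hu0] using hv
  -- Subtracting elements of `F` terminates because it lowers the value of `h`.
  have hcov : ∀ n : ℕ, ∀ x ∈ irrStd A F a, (h ⬝ᵥ x).toNat ≤ n →
      ∃ b ∈ B, x - b ∈ semigp F := by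
    intro n
    induction n with
    | zero =>
      intro x hx hn
      refine ⟨x, ⟨hx, fun f hf hxf => ?_⟩, by simp⟩
      have h1 := hh.nonneg hxf
      have h2 := hpos f hf
      rw [dotProduct_sub] at h1
      omega
    | succ n ih =>
      intro x hx hn
      by_cases hmin : ∀ f ∈ F, x - f ∉ semigp A
      · exact ⟨x, ⟨hx, hmin⟩, by simp⟩
      · push Not at hmin
        obtain ⟨f, hf, hxf⟩ := hmin
        have hfF : f ∈ semigp F := AddSubmonoid.subset_closure hf
        obtain ⟨b, hb, hxb⟩ := ih (x - f)
          (mem_irrStd_of_add_mem hxf (hℓ.semigp_le hfF) (by rwa [sub_add_cancel])) (by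
            have h1 := hh.nonneg hxf
            have h2 := hpos f hf
            rw [dotProduct_sub] at h1 ⊢
            omega)
        refine ⟨b, hb, ?_⟩
        rw [show x - b = x - f - b + f by abel]
        exact add_mem hxb hfF
  -- The generators are the nonstandard neighbours of `B`.
  refine ⟨B, Set.image2 (· + ·) B A \ irrStd A F a, hB,
    (hB.image2 _ hA).subset Set.sdiff_subset, ?_, fun b hb => hb.1, ?_, ?_, ?_⟩
  · refine ⟨⟨zero_mem _, by simpa using mem_loc_of_mem_semigp ha⟩, fun f hf hmem => ?_⟩
    have h1 := hh.nonneg hmem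
    have h2 := hpos f hf
    rw [zero_sub, dotProduct_neg] at h1
    omega
  · intro b hb c hc
    by_cases hbc : b + c ∈ irrStd A F a
    · exact Or.inl (hcov _ _ hbc le_rfl)
    · exact Or.inr ⟨b + c, ⟨⟨b, hb, c, hc, rfl⟩, hbc⟩, by simp⟩
  · rintro _ ⟨⟨b, hb, c, hc, rfl⟩, hbc⟩
    have := add_mem hb.1.1 (AddSubmonoid.subset_closure hc)
    exact ⟨this, fun h => hbc ⟨this, h⟩⟩
  · intro b hb b' hb'
    by_contra hcon
    push Not at hcon
    obtain ⟨f, hf, u, hu, hbu⟩ := exists_add_of_mem_closure hcon.2 (sub_ne_zero.2 hcon.1)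
    refine hb.2 f hf ?_
    rw [show b - f = b' + (b - b' - f) by abel, hbu, add_sub_cancel_left]
    exact add_mem hb'.1.1 (hℓ.semigp_le hu)

/-- A finite list has an irredundant cofinal sublist with respect to a preorder. -/
theorem exists_pairwise_cofinal {α : Type*} (r : α → α → Prop) (hrefl : ∀ x, r x x)
    (htrans : ∀ x y z, r x y → r y z → r x z) (l : List α) :
    ∃ K : List α, (∀ x ∈ K, x ∈ l) ∧ (∀ x ∈ l, ∃ y ∈ K, r x y) ∧
      K.Pairwise fun x y => ¬ r x y ∧ ¬ r y x := by
  classical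
  induction l with
  | nil => exact ⟨[], by simp, by simp, List.Pairwise.nil⟩
  | cons a l ih =>
    obtain ⟨K, hKl, hcof, hK⟩ := ih
    by_cases ha : ∃ y ∈ K, r a y
    · refine ⟨K, fun x hx => List.mem_cons_of_mem _ (hKl x hx), fun x hx => ?_, hK⟩
      rcases List.mem_cons.1 hx with rfl | hx
      · exact ha
      · exact hcof x hx
    · push Not at ha
      -- A new element below nothing kept so far replaces the elements below it.
      refine ⟨a :: K.filter fun y => ¬ r y a, ?_, ?_, ?_⟩
      · intro x hx
        rcases List.mem_cons.1 hx with rfl | hx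
        · exact List.mem_cons_self
        · exact List.mem_cons_of_mem _ (hKl x (List.mem_of_mem_filter hx))
      · intro x hx
        rcases List.mem_cons.1 hx with rfl | hx
        · exact ⟨x, List.mem_cons_self, hrefl x⟩
        · obtain ⟨y, hy, hxy⟩ := hcof x hx
          by_cases hya : r y a
          · exact ⟨a, List.mem_cons_self, htrans x y a hxy hya⟩
          · exact ⟨y, List.mem_cons_of_mem _ (List.mem_filter.2 ⟨hy, by simpa using hya⟩), hxy⟩
      · refine List.pairwise_cons.2 ⟨fun y hy => ?_, hK.filter _⟩
        have := List.mem_filter.1 hy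
        exact ⟨ha y this.1, by simpa using this.2⟩

end StdPairs

namespace StdPairs

/-! Vector arithmetic on lists of integers. -/

/-- The lattice point with the given list of coordinates. -/
def pt (d : ℕ) (u : List ℤ) : Pt d := fun i => u.getD i 0

/-- Addition of encoded lattice points. -/
def vadd (d : ℕ) (u v : List ℤ) : List ℤ :=
  (List.range d).map fun i => u.getD i 0 + v.getD i 0

/-- Subtraction of encoded lattice points. -/
def vsub (d : ℕ) (u v : List ℤ) : List ℤ :=
  (List.range d).map fun i => u.getD i 0 + -v.getD i 0

/-- The dot product of encoded lattice points. -/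
def vdot (d : ℕ) (u v : List ℤ) : ℤ :=
  ((List.range d).map fun i => u.getD i 0 * v.getD i 0).foldr (· + ·) 0

/-- The sum of a list of encoded lattice points. -/
def vsum (d : ℕ) (l : List (List ℤ)) : List ℤ := l.foldr (vadd d) (vadd d [] [])

theorem pt_codePt {d : ℕ} (a : Pt d) : pt d (codePt a) = a := by
  ext i
  simp [pt, codePt]

theorem codePt_injective {d : ℕ} : Function.Injective (codePt (d := d)) :=
  Function.LeftInverse.injective pt_codePt

theorem map_range_eq_codePt {d : ℕ} (f : ℕ → ℤ) :
    (List.range d).map f = codePt (fun i : Fin d => f i) := by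
  refine List.ext_getElem (by simp [codePt]) fun i h _ => ?_
  simp [codePt]

/-- The result has length `d` whatever the lengths of the arguments, so `vadd d b [] = b` tests that
`b` is a genuine code. -/
theorem vadd_eq {d : ℕ} (u v : List ℤ) : vadd d u v = codePt (pt d u + pt d v) :=
  map_range_eq_codePt _

theorem vsub_eq {d : ℕ} (u v : List ℤ) : vsub d u v = codePt (pt d u - pt d v) := by
  rw [vsub, map_range_eq_codePt, sub_eq_add_neg]
  rfl

theorem vdot_eq {d : ℕ} (u v : List ℤ) : vdot d u v = pt d u ⬝ᵥ pt d v :=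
  (Fin.sum_univ_eq_sum_range (fun i => u.getD i 0 * v.getD i 0) d).symm

theorem pt_nil {d : ℕ} : pt d [] = 0 := by
  ext i
  simp [pt]

theorem vsum_codePts {d : ℕ} (l : List (Pt d)) : vsum d (codePts l) = codePt l.sum := by
  induction l with
  | nil => simp [vsum, codePts, vadd_eq, pt_nil]
  | cons a l ih =>
    change vadd d (codePt a) (vsum d (codePts l)) = _
    rw [ih, vadd_eq, pt_codePt, pt_codePt, List.sum_cons]

theorem mem_codePts {d : ℕ} {a : Pt d} {l : List (Pt d)} : codePt a ∈ codePts l ↔ a ∈ l :=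
  List.mem_map_of_injective codePt_injective

theorem exists_codePts_eq {d : ℕ} {l : List (List ℤ)} (h : ∀ y ∈ l, ∃ a : Pt d, codePt a = y) :
    ∃ l' : List (Pt d), codePts l' = l := by
  refine ⟨l.map (pt d), ?_⟩
  rw [codePts, List.map_map]
  conv_rhs => rw [← List.map_id l]
  refine List.map_congr_left fun y hy => ?_
  obtain ⟨a, rfl⟩ := h y hy
  simp [pt_codePt]

theorem forall_mem_codePts {d : ℕ} {l : List (Pt d)} {p : List ℤ → Prop} :
    (∀ y ∈ codePts l, p y) ↔ ∀ a ∈ l, p (codePt a) := by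
  simp [codePts]

theorem exists_mem_codePts {d : ℕ} {l : List (Pt d)} {p : List ℤ → Prop} :
    (∃ y ∈ codePts l, p y) ↔ ∃ a ∈ l, p (codePt a) := by
  simp [codePts]

/-! Certified membership, on codes. -/

/-- Code version of membership in `ℕA - ℕF`. -/
def PosCode (d : ℕ) (A F : List (List ℤ)) (x : List ℤ) : Prop :=
  ∃ l m : List (List ℤ), (∀ y ∈ l, y ∈ A) ∧ (∀ y ∈ m, y ∈ F) ∧ vadd d x (vsum d m) = vsum d l

/-- Code version of `NegCert`. -/
def NegCode (d : ℕ) (A F : List (List ℤ)) (x : List ℤ) : Prop :=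
  ∃ (ℓ : List ℤ) (Z : List (List ℤ)), x ∈ Z ∧ (∀ a ∈ A, 0 < vdot d ℓ a ∨ vdot d ℓ a = 0) ∧
    (∀ f ∈ F, vdot d ℓ f = 0) ∧
    (∀ z ∈ Z, ∀ a ∈ A, a ∈ F ∨ vsub d z a ∈ Z ∨ vdot d ℓ z < vdot d ℓ a) ∧
    ∀ z ∈ Z, ∃ (y : List ℤ) (q : ℤ), (∀ f ∈ F, ∃ c, vdot d y f = q * c) ∧
      ∃ c r, vdot d y z = q * c + r ∧ 0 < r ∧ r < q

theorem posCode_iff {d : ℕ} {A F : List (Pt d)} {x : Pt d} :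
    PosCode d (codePts A) (codePts F) (codePt x) ↔ x ∈ loc (listSet A) (listSet F) := by
  constructor
  · rintro ⟨l, m, hl, hm, h⟩
    obtain ⟨l, rfl⟩ := exists_codePts_eq (d := d) (l := l) fun y hy => by
      obtain ⟨a, -, ha⟩ := List.mem_map.1 (hl y hy)
      exact ⟨a, ha⟩
    obtain ⟨m, rfl⟩ := exists_codePts_eq (d := d) (l := m) fun y hy => by
      obtain ⟨a, -, ha⟩ := List.mem_map.1 (hm y hy)
      exact ⟨a, ha⟩
    rw [vsum_codePts, vsum_codePts, vadd_eq, pt_codePt, pt_codePt] at h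
    rw [forall_mem_codePts] at hl hm
    refine ⟨m.sum, list_sum_mem fun y hy => AddSubmonoid.subset_closure (mem_codePts.1 (hm y hy)),
      ?_⟩
    rw [codePt_injective h]
    exact list_sum_mem fun y hy => AddSubmonoid.subset_closure (mem_codePts.1 (hl y hy))
  · rintro ⟨f, hf, hx⟩
    obtain ⟨m, hm, rfl⟩ := AddSubmonoid.exists_list_of_mem_closure hf
    obtain ⟨l, hl, hlx⟩ := AddSubmonoid.exists_list_of_mem_closure hx
    refine ⟨codePts l, codePts m, ?_, ?_, ?_⟩
    · exact forall_mem_codePts.2 fun a ha => mem_codePts.2 (hl a ha)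
    · exact forall_mem_codePts.2 fun a ha => mem_codePts.2 (hm a ha)
    · rw [vsum_codePts, vsum_codePts, vadd_eq, pt_codePt, pt_codePt, hlx]

theorem negCode_iff {d : ℕ} {A F : List (Pt d)} {x : Pt d} :
    NegCode d (codePts A) (codePts F) (codePt x) ↔ NegCert (listSet A) (listSet F) x := by
  constructor
  · rintro ⟨ℓ, Z, hx, hA, hF, hstep, hsep⟩
    simp only [forall_mem_codePts, vdot_eq, vsub_eq, pt_codePt, mem_codePts] at hA hF hstep hsep
    refine ⟨pt d ℓ, Z.map (pt d), List.mem_map.2 ⟨_, hx, pt_codePt x⟩, fun a ha => ?_, hF, ?_, ?_⟩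
    · exact (hA a ha).elim le_of_lt Eq.ge
    · intro z hz a ha
      obtain ⟨z, hzZ, rfl⟩ := List.mem_map.1 hz
      exact (hstep z hzZ a ha).imp_right
        (Or.imp_left fun h => List.mem_map.2 ⟨_, h, pt_codePt _⟩)
    · intro z hz
      obtain ⟨z, hzZ, rfl⟩ := List.mem_map.1 hz
      obtain ⟨y, q, h⟩ := hsep z hzZ
      exact ⟨pt d y, q, h⟩
  · rintro ⟨ℓ, Z, hx, hA, hF, hstep, hsep⟩
    refine ⟨codePt ℓ, codePts Z, mem_codePts.2 hx, ?_⟩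
    simp only [forall_mem_codePts, vdot_eq, vsub_eq, pt_codePt, mem_codePts]
    refine ⟨fun a ha => ?_, hF, hstep, fun z hz => ?_⟩
    · exact (lt_or_eq_of_le (hA a ha)).imp_right Eq.symm
    · obtain ⟨y, q, h⟩ := hsep z hz
      refine ⟨codePt y, q, ?_⟩
      simp only [pt_codePt]
      exact h

/-! Semidecidability. -/

section Primrec

variable {α : Type*} [Primcodable α] {d : α → ℕ} {A F : α → List (List ℤ)}
  {u v x : α → List ℤ}

theorem primrec_vadd (hd : Primrec d) (hu : Primrec u) (hv : Primrec v) :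
    Primrec fun a => vadd (d a) (u a) (v a) :=
  Primrec.list_map (Primrec.list_range.comp hd)
    (primrec_int_add.comp ((Primrec.list_getD 0).comp (hu.comp .fst) .snd)
      ((Primrec.list_getD 0).comp (hv.comp .fst) .snd)).to₂

theorem primrec_vsub (hd : Primrec d) (hu : Primrec u) (hv : Primrec v) :
    Primrec fun a => vsub (d a) (u a) (v a) :=
  Primrec.list_map (Primrec.list_range.comp hd)
    (primrec_int_add.comp ((Primrec.list_getD 0).comp (hu.comp .fst) .snd)
      (primrec_int_neg.comp ((Primrec.list_getD 0).comp (hv.comp .fst) .snd))).to₂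

theorem primrec_vdot (hd : Primrec d) (hu : Primrec u) (hv : Primrec v) :
    Primrec fun a => vdot (d a) (u a) (v a) := by
  have h : Primrec fun a => (List.range (d a)).map fun i => (u a).getD i 0 * (v a).getD i 0 :=
    Primrec.list_map (Primrec.list_range.comp hd)
      (primrec_int_mul.comp ((Primrec.list_getD 0).comp (hu.comp .fst) .snd)
        ((Primrec.list_getD 0).comp (hv.comp .fst) .snd)).to₂
  exact Primrec.list_foldr (h := fun _ p => p.1 + p.2) h (Primrec.const 0)
    (primrec_int_add.comp (Primrec.fst.comp .snd) (Primrec.snd.comp .snd)).to₂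

theorem primrec_vsum (hd : Primrec d) (hA : Primrec A) : Primrec fun a => vsum (d a) (A a) :=
  Primrec.list_foldr (h := fun a p => vadd (d a) p.1 p.2) hA
    (primrec_vadd hd (.const []) (.const []))
    (primrec_vadd (hd.comp .fst) (Primrec.fst.comp .snd) (Primrec.snd.comp .snd)).to₂

namespace Semidec

theorem eq {β : Type*} [Primcodable β] {s t : α → β} (hs : Primrec s) (ht : Primrec t) :
    Semidec fun a => s a = t a :=
  of_primrecPred (Primrec.eq.comp hs ht)

theorem int_lt {s t : α → ℤ} (hs : Primrec s) (ht : Primrec t) : Semidec fun a => s a < t a :=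
  of_primrecPred (primrec_int_lt.comp hs ht)

theorem notMem {β : Type*} [Primcodable β] {l : α → List β} {b : α → β} (hb : Primrec b)
    (hl : Primrec l) : Semidec fun a => b a ∉ l a := by
  have h : PrimrecRel fun (x y : β) => x = y := Primrec.eq
  exact of_primrecPred ((h.exists_mem_list.comp hl hb).not.of_eq fun a => by simp)

theorem posCode (hd : Primrec d) (hA : Primrec A) (hF : Primrec F) (hx : Primrec x) :
    Semidec fun a => PosCode (d a) (A a) (F a) (x a) := by
  refine ex (ex (and ?_ (and ?_ ?_)))
  · exact all_mem (Primrec.snd.comp .fst) (mem .snd (hA.comp (Primrec.fst.comp (.comp .fst .fst))))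
  · exact all_mem .snd (mem .snd (hF.comp (Primrec.fst.comp (.comp .fst .fst))))
  · have hd' := hd.comp (Primrec.fst.comp (Primrec.fst (α := α × List (List ℤ))
      (β := List (List ℤ))))
    exact eq (primrec_vadd hd' (hx.comp (Primrec.fst.comp .fst)) (primrec_vsum hd' .snd))
      (primrec_vsum hd' (Primrec.snd.comp .fst))

theorem negCode (hd : Primrec d) (hA : Primrec A) (hF : Primrec F) (hx : Primrec x) :
    Semidec fun a => NegCode (d a) (A a) (F a) (x a) := by
  refine ex (ex (and ?_ (and ?_ (and ?_ (and ?_ ?_)))))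
  all_goals
    have h1 : Primrec fun c : (α × List ℤ) × List (List ℤ) => c.1.1 := Primrec.fst.comp .fst
    have hl : Primrec fun c : (α × List ℤ) × List (List ℤ) => c.1.2 := Primrec.snd.comp .fst
    have hZ : Primrec fun c : (α × List ℤ) × List (List ℤ) => c.2 := .snd
    replace hd := hd.comp h1
    replace hA := hA.comp h1
    replace hF := hF.comp h1
    replace hx := hx.comp h1
  · exact mem hx hZ
  · have h := primrec_vdot (hd.comp .fst) (hl.comp .fst) (.snd (β := List ℤ))
    exact all_mem hA (or (int_lt (.const 0) h) (eq h (.const 0)))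
  · exact all_mem hF (eq (primrec_vdot (hd.comp .fst) (hl.comp .fst) .snd) (.const 0))
  · refine all_mem hZ (all_mem (hA.comp .fst) (or ?_ (or ?_ ?_)))
    · exact mem .snd (hF.comp (.comp .fst .fst))
    · exact mem (primrec_vsub (hd.comp (.comp .fst .fst)) (.comp .snd .fst) .snd)
        (hZ.comp (.comp .fst .fst))
    · exact int_lt
        (primrec_vdot (hd.comp (.comp .fst .fst)) (hl.comp (.comp .fst .fst)) (.comp .snd .fst))
        (primrec_vdot (hd.comp (.comp .fst .fst)) (hl.comp (.comp .fst .fst)) .snd)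
  · refine all_mem hZ (ex (ex (and ?_ (ex (ex (and ?_ (and ?_ ?_)))))))
    · refine all_mem (hF.comp (.comp .fst (.comp .fst .fst))) (ex (eq ?_ ?_))
      · exact primrec_vdot (hd.comp (.comp .fst (.comp .fst (.comp .fst (.comp .fst .fst)))))
          (.comp .snd (.comp .fst (.comp .fst .fst))) (.comp .snd .fst)
      · exact primrec_int_mul.comp (.comp .snd (.comp .fst .fst)) .snd
    · refine eq ?_ (primrec_int_add.comp (primrec_int_mul.comp ?_ ?_) .snd)
      · exact primrec_vdot (hd.comp (.comp .fst (.comp .fst (.comp .fst (.comp .fst .fst)))))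
          (.comp .snd (.comp .fst (.comp .fst .fst)))
          (.comp .snd (.comp .fst (.comp .fst (.comp .fst .fst))))
      · exact .comp .snd (.comp .fst .fst)
      · exact .comp .snd .fst
    · exact int_lt (.const 0) .snd
    · exact int_lt .snd (.comp .snd (.comp .fst .fst))

end Semidec

end Primrec

end StdPairs

namespace StdPairs

/-! The certified output. -/

/-- Code version of `IsComponent`, for lists of lattice points in normal form. -/
def ComponentCode (d : ℕ) (A : List (List ℤ)) (a : List ℤ) (F B G : List (List ℤ)) : Prop :=
  (∀ b ∈ B, vadd d b [] = b) ∧ (∀ g ∈ G, vadd d g [] = g) ∧ vadd d [] [] ∈ B ∧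
  (∀ b ∈ B, PosCode d A [] b ∧ PosCode d A F (vsub d a b)) ∧
  (∀ b ∈ B, ∀ c ∈ A, (∃ b' ∈ B, PosCode d F [] (vsub d (vadd d b c) b')) ∨
    ∃ g ∈ G, PosCode d A [] (vsub d (vadd d b c) g)) ∧
  (∀ g ∈ G, PosCode d A [] g ∧ NegCode d A F (vsub d a g)) ∧
  ∀ b ∈ B, ∀ b' ∈ B, b = b' ∨ NegCode d F [] (vsub d b b')

/-- The data found by the search: a pair, with the points of the standard pairs and the
generators of its ideal. -/
abbrev Entry (α : Type) : Type := (α × List α) × List α × List α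

/-- The entries `D` certify a decomposition, for the input `(d, A, P)`. -/
def ValidCode (d : ℕ) (A : List (List ℤ)) (P : List (List ℤ × List (List ℤ)))
    (D : List (Entry (List ℤ))) : Prop :=
  (∀ e ∈ D, e.1 ∈ P ∧ ComponentCode d A e.1.1 e.1.2 e.2.1 e.2.2) ∧
  (∀ p ∈ P, ∃ e ∈ D, (∀ f ∈ p.2, f ∈ e.1.2) ∧ PosCode d A e.1.2 (vsub d e.1.1 p.1)) ∧
  ∀ i ∈ List.range D.length, ∀ j ∈ List.range D.length, i = j ∨
    ∃ e e', D[i]? = some e ∧ D[j]? = some e' ∧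
      ((∃ f ∈ e.1.2, f ∉ e'.1.2) ∨ NegCode d A e'.1.2 (vsub d e'.1.1 e.1.1))

theorem listSet_nil {α : Type*} : listSet ([] : List α) = ∅ := by
  ext
  simp [listSet]

/-- Non-membership in `ℕF` is certified by regarding `F` as a configuration with empty face, cut out
by the same positive `h`. -/
theorem componentCode_iff {d : ℕ} {A F B G : List (Pt d)} {a ℓ h : Pt d}
    (hℓ : CutsOut (listSet A) (listSet F) ℓ) (hh : CutsOut (listSet A) ∅ h) :
    ComponentCode d (codePts A) (codePt a) (codePts F) (codePts B) (codePts G) ↔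
      IsComponent (listSet A) (listSet F) a (listSet B) (listSet G) := by
  have hhF : CutsOut (listSet F) (listSet []) h := by
    rw [listSet_nil]
    exact ⟨Set.empty_subset _, by simp, fun f hf _ => hh.pos f (hℓ.subset hf) (by simp)⟩
  have hA : (listSet A).Finite := List.finite_toSet A
  have hF : (listSet F).Finite := List.finite_toSet F
  have hnil : ([] : List (List ℤ)) = codePts ([] : List (Pt d)) := rfl
  simp only [ComponentCode, forall_mem_codePts, exists_mem_codePts, vadd_eq, vsub_eq, pt_codePt,
    pt_nil, add_zero, mem_codePts, implies_true, true_and]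
  rw [hnil]
  simp only [posCode_iff, negCode_iff, hℓ.negCert_iff hA, hhF.negCert_iff hF]
  simp only [listSet_nil, mem_loc_empty, codePt_injective.eq_iff]
  exact ⟨fun ⟨h1, h2, h3, h4, h5⟩ => ⟨h1, h2, h3, h4, h5⟩,
    fun h => ⟨h.zero_mem, h.std, h.step, h.gens, h.sep⟩⟩

namespace Semidec

variable {α : Type*} [Primcodable α] {d : α → ℕ} {A F B G : α → List (List ℤ)}
  {a : α → List ℤ} {P : α → List (List ℤ × List (List ℤ))} {D : α → List (Entry (List ℤ))}

theorem componentCode (hd : Primrec d) (hA : Primrec A) (ha : Primrec a) (hF : Primrec F)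
    (hB : Primrec B) (hG : Primrec G) :
    Semidec fun x => ComponentCode (d x) (A x) (a x) (F x) (B x) (G x) := by
  have hn : ∀ {L : α → List (List ℤ)}, Primrec L →
      Semidec fun x => ∀ b ∈ L x, vadd (d x) b [] = b := fun hL =>
    all_mem hL (eq (primrec_vadd (hd.comp .fst) .snd (.const [])) .snd)
  refine and (hn hB) (and (hn hG) (and (mem (primrec_vadd hd (.const []) (.const [])) hB)
    (and ?_ (and ?_ (and ?_ ?_)))))
  · exact all_mem hB (and (posCode (hd.comp .fst) (hA.comp .fst) (.const []) .snd)
      (posCode (hd.comp .fst) (hA.comp .fst) (hF.comp .fst)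
        (primrec_vsub (hd.comp .fst) (ha.comp .fst) .snd)))
  · have hd₂ : Primrec fun x : (α × List ℤ) × List ℤ => d x.1.1 := hd.comp (.comp .fst .fst)
    have hd₃ : Primrec fun x : ((α × List ℤ) × List ℤ) × List ℤ => d x.1.1.1 := hd₂.comp .fst
    have hv : Primrec fun x : ((α × List ℤ) × List ℤ) × List ℤ =>
        vsub (d x.1.1.1) (vadd (d x.1.1.1) x.1.1.2 x.1.2) x.2 :=
      primrec_vsub hd₃ (primrec_vadd hd₃ (.comp .snd (.comp .fst .fst)) (.comp .snd .fst)) .snd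
    exact all_mem hB (all_mem (hA.comp .fst) (or
      (ex_mem (hB.comp (.comp .fst .fst))
        (posCode hd₃ (hF.comp (.comp .fst (.comp .fst .fst))) (.const []) hv))
      (ex_mem (hG.comp (.comp .fst .fst))
        (posCode hd₃ (hA.comp (.comp .fst (.comp .fst .fst))) (.const []) hv))))
  · exact all_mem hG (and (posCode (hd.comp .fst) (hA.comp .fst) (.const []) .snd)
      (negCode (hd.comp .fst) (hA.comp .fst) (hF.comp .fst)
        (primrec_vsub (hd.comp .fst) (ha.comp .fst) .snd)))
  · exact all_mem hB (all_mem (hB.comp .fst) (or (eq (.comp .snd .fst) .snd)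
      (negCode (hd.comp (.comp .fst .fst)) (hF.comp (.comp .fst .fst)) (.const [])
        (primrec_vsub (hd.comp (.comp .fst .fst)) (.comp .snd .fst) .snd))))

theorem validCode (hd : Primrec d) (hA : Primrec A) (hP : Primrec P) (hD : Primrec D) :
    Semidec fun x => ValidCode (d x) (A x) (P x) (D x) := by
  refine and ?_ (and ?_ ?_)
  · have he : Primrec fun x : α × Entry (List ℤ) => x.2 := .snd
    exact all_mem hD (and (mem (.comp .fst he) (hP.comp .fst))
      (componentCode (hd.comp .fst) (hA.comp .fst) (.comp .fst (.comp .fst he))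
        (.comp .snd (.comp .fst he)) (.comp .fst (.comp .snd he)) (.comp .snd (.comp .snd he))))
  · refine all_mem hP (ex_mem (hD.comp .fst) (and ?_ ?_))
    · exact all_mem (.comp .snd (.comp .snd .fst))
        (mem .snd (.comp .snd (.comp .fst (.comp .snd .fst))))
    · have hd₂ : Primrec fun x : (α × (List ℤ × List (List ℤ))) × Entry (List ℤ) => d x.1.1 :=
        hd.comp (.comp .fst .fst)
      exact posCode hd₂ (hA.comp (.comp .fst .fst)) (.comp .snd (.comp .fst .snd))
        (primrec_vsub hd₂ (.comp .fst (.comp .fst .snd)) (.comp .fst (.comp .snd .fst)))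
  · have hr : Primrec fun x => List.range (D x).length :=
      Primrec.list_range.comp (Primrec.list_length.comp hD)
    have h₀ : Primrec fun x : (((α × ℕ) × ℕ) × Entry (List ℤ)) × Entry (List ℤ) => x.1.1.1.1 :=
      .comp .fst (.comp .fst (.comp .fst .fst))
    have he : Primrec fun x : (((α × ℕ) × ℕ) × Entry (List ℤ)) × Entry (List ℤ) => x.1.2 :=
      .comp .snd .fst
    have he' : Primrec fun x : (((α × ℕ) × ℕ) × Entry (List ℤ)) × Entry (List ℤ) => x.2 := .snd
    refine all_mem hr (all_mem (hr.comp .fst) (or (eq (.comp .snd .fst) .snd)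
      (ex (ex (and ?_ (and ?_ (or ?_ ?_)))))))
    · exact eq (Primrec.list_getElem?.comp (hD.comp h₀)
        (.comp .snd (.comp .fst (.comp .fst .fst)))) (Primrec.option_some.comp he)
    · exact eq (Primrec.list_getElem?.comp (hD.comp h₀)
        (.comp .snd (.comp .fst .fst))) (Primrec.option_some.comp he')
    · exact ex_mem (.comp .snd (.comp .fst he))
        (notMem .snd (.comp .snd (.comp .fst (he'.comp .fst))))
    · exact negCode (hd.comp h₀) (hA.comp h₀) (.comp .snd (.comp .fst he'))
        (primrec_vsub (hd.comp h₀) (.comp .fst (.comp .fst he')) (.comp .fst (.comp .fst he)))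

end Semidec

end StdPairs

/-! ### Existence and correctness of certified output. -/

namespace StdPairs

variable {d : ℕ}

/-- The pair presented by a point and a list. -/
def toPair (p : Pt d × List (Pt d)) : Pt d × Set (Pt d) := (p.1, listSet p.2)

/-- Encoding of entries. -/
def codeEntry (e : Entry (Pt d)) : Entry (List ℤ) :=
  ((codePt e.1.1, codePts e.1.2), codePts e.2.1, codePts e.2.2)

/-- The component described by an entry. -/
def component {α : Type} (e : Entry α) : List (α × List α) × List α :=
  (e.2.1.map fun b => (b, e.1.2), e.2.2)

theorem codeComponents_map_component (D : List (Entry (Pt d))) :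
    codeComponents (D.map component) = (D.map codeEntry).map component := by
  rw [codeComponents, List.map_map, List.map_map]
  refine List.map_congr_left fun e _ => ?_
  simp [component, codeEntry, codePairs, codePts]

theorem primrec_map_component :
    Primrec fun D : List (Entry (List ℤ)) => D.map component := by
  refine Primrec.list_map .id ?_
  have he : Primrec fun x : List (Entry (List ℤ)) × Entry (List ℤ) => x.2 := .snd
  exact ((Primrec.list_map (.comp .fst (.comp .snd he))
    (Primrec.pair .snd (.comp .snd (.comp .fst (he.comp .fst)))).to₂).pair
      (.comp .snd (.comp .snd he))).to₂

theorem exists_map_eq {α β : Type*} {f : α → β} {p : α → Prop} {l : List β}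
    (h : ∀ y ∈ l, ∃ x, p x ∧ f x = y) : ∃ l' : List α, (∀ x ∈ l', p x) ∧ l'.map f = l := by
  induction l with
  | nil => exact ⟨[], by simp, rfl⟩
  | cons y l ih =>
    obtain ⟨x, hx, hxy⟩ := h y (by simp)
    obtain ⟨l', hl', hl⟩ := ih fun z hz => h z (by simp [hz])
    exact ⟨x :: l', by simpa using ⟨hx, hl'⟩, by rw [List.map_cons, hxy, hl]⟩

theorem codePairs_mem_iff {P : List (Pt d × List (Pt d))} {e : List ℤ × List (List ℤ)} :
    e ∈ codePairs P ↔ ∃ p ∈ P, (codePt p.1, codePts p.2) = e :=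
  List.mem_map

theorem pairLE_iff {A F G : List (Pt d)} {a b : Pt d} :
    PairLE (listSet A) (toPair (a, F)) (toPair (b, G)) ↔
      (∀ f ∈ codePts F, f ∈ codePts G) ∧
        PosCode d (codePts A) (codePts G) (vsub d (codePt b) (codePt a)) := by
  rw [vsub_eq, pt_codePt, pt_codePt, posCode_iff, forall_mem_codePts]
  simp only [mem_codePts]
  rfl

/-- Makes the failure of comparability, needed for irredundancy, semidecidable. -/
theorem not_pairLE_iff {A F G : List (Pt d)} {a b ℓ : Pt d}
    (hG : CutsOut (listSet A) (listSet G) ℓ) :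
    ¬ PairLE (listSet A) (toPair (a, F)) (toPair (b, G)) ↔
      (∃ f ∈ codePts F, f ∉ codePts G) ∨
        NegCode d (codePts A) (codePts G) (vsub d (codePt b) (codePt a)) := by
  rw [pairLE_iff, not_and_or, vsub_eq, pt_codePt, pt_codePt, posCode_iff, negCode_iff,
    hG.negCert_iff (List.finite_toSet A)]
  push Not
  rfl

/-- Guarantees that the search halts: maximal representatives among the input pairs, with the
components built above, are valid data. -/
theorem exists_validCode {A : List (Pt d)} {h : Pt d} (hh : CutsOut (listSet A) ∅ h)
    {P : List (Pt d × List (Pt d))} (hP : ∀ p ∈ P, IsPair (listSet A) (toPair p)) :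
    ∃ D, ValidCode d (codePts A) (codePairs P) D := by
  have hA : (listSet A).Finite := List.finite_toSet A
  obtain ⟨K, hKP, hcof, hK⟩ := exists_pairwise_cofinal
    (fun p q : Pt d × List (Pt d) => PairLE (listSet A) (toPair p) (toPair q))
    (fun _ => PairLE.refl _) (fun _ _ _ h h' => h.trans h') P
  have hcut : ∀ p ∈ P, ∃ ℓ, CutsOut (listSet A) (listSet p.2) ℓ := fun p hp =>
    (hP p hp).2.exists_cutsOut hA
  have hex : ∀ p ∈ P, ∃ B G : List (Pt d),
      IsComponent (listSet A) (listSet p.2) p.1 (listSet B) (listSet G) := by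
    intro p hp
    obtain ⟨ℓ, hℓ⟩ := hcut p hp
    obtain ⟨B, G, hB, hG, hBG⟩ := hℓ.exists_isComponent hA hh (hP p hp).1
    refine ⟨hB.toFinset.toList, hG.toFinset.toList, ?_⟩
    have : ∀ {S : Set (Pt d)} (hS : S.Finite), listSet hS.toFinset.toList = S := fun hS => by
      ext
      simp [listSet]
    rwa [this, this]
  choose! B G hBG using hex
  refine ⟨K.map fun p => codeEntry (p, B p, G p), ?_, ?_, ?_⟩
  · intro e he
    obtain ⟨p, hp, rfl⟩ := List.mem_map.1 he
    obtain ⟨ℓ, hℓ⟩ := hcut p (hKP p hp)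
    exact ⟨codePairs_mem_iff.2 ⟨p, hKP p hp, rfl⟩,
      (componentCode_iff hℓ hh).2 (hBG p (hKP p hp))⟩
  · intro e he
    obtain ⟨p, hp, rfl⟩ := codePairs_mem_iff.1 he
    obtain ⟨q, hq, hpq⟩ := hcof p hp
    exact ⟨_, List.mem_map.2 ⟨q, hq, rfl⟩, pairLE_iff.1 hpq⟩
  · intro i hi j hj
    rw [List.mem_range, List.length_map] at hi hj
    refine or_iff_not_imp_left.2 fun hij => ?_
    refine ⟨_, _, List.getElem?_eq_getElem (by simpa using hi),
      List.getElem?_eq_getElem (by simpa using hj), ?_⟩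
    rw [List.getElem_map, List.getElem_map]
    obtain ⟨ℓ, hℓ⟩ := hcut K[j] (hKP _ (List.getElem_mem hj))
    refine (not_pairLE_iff hℓ).1 ?_
    rcases lt_or_gt_of_ne hij with hlt | hlt
    · exact (List.pairwise_iff_getElem.1 hK i j hi hj hlt).1
    · exact (List.pairwise_iff_getElem.1 hK j i hj hi hlt).2

/-- Soundness for arbitrary valid data, since the search may return something other than the data
constructed for existence. -/
theorem ValidCode.exists_entries {A : List (Pt d)} {h : Pt d} (hh : CutsOut (listSet A) ∅ h)
    {P : List (Pt d × List (Pt d))} (hP : ∀ p ∈ P, IsPair (listSet A) (toPair p))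
    {D : List (Entry (List ℤ))} (hD : ValidCode d (codePts A) (codePairs P) D) :
    ∃ E : List (Entry (Pt d)), E.map codeEntry = D ∧
      (∀ e ∈ E, e.1 ∈ P ∧ IsComponent (listSet A) (listSet e.1.2) e.1.1 (listSet e.2.1)
        (listSet e.2.2)) ∧
      (∀ p ∈ P, ∃ e ∈ E, PairLE (listSet A) (toPair p) (toPair e.1)) ∧
      ∀ (i j : ℕ) (hi : i < E.length) (hj : j < E.length), i ≠ j →
        ¬ PairLE (listSet A) (toPair E[i].1) (toPair E[j].1) := by
  obtain ⟨hD₁, hD₂, hD₃⟩ := hD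
  have hA : (listSet A).Finite := List.finite_toSet A
  have hcut : ∀ p ∈ P, ∃ ℓ, CutsOut (listSet A) (listSet p.2) ℓ := fun p hp =>
    (hP p hp).2.exists_cutsOut hA
  obtain ⟨E, hEP, rfl⟩ := exists_map_eq (f := codeEntry (d := d)) (p := fun e => e.1 ∈ P)
    (l := D) (by
    intro e he
    obtain ⟨heP, hB, hG, -⟩ := hD₁ e he
    obtain ⟨p, hp, hpe⟩ := codePairs_mem_iff.1 heP
    have hnorm : ∀ {L : List (List ℤ)}, (∀ b ∈ L, vadd d b [] = b) →
        ∃ L' : List (Pt d), codePts L' = L := fun hL =>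
      exists_codePts_eq fun y hy => ⟨_, (vadd_eq y []).symm.trans (hL y hy)⟩
    obtain ⟨B, hB⟩ := hnorm hB
    obtain ⟨G, hG⟩ := hnorm hG
    exact ⟨(p, B, G), hp, by rw [codeEntry, hpe, hB, hG]⟩)
  refine ⟨E, rfl, fun e he => ?_, fun p hp => ?_, fun i j hi hj hij => ?_⟩
  · obtain ⟨ℓ, hℓ⟩ := hcut _ (hEP e he)
    exact ⟨hEP e he, (componentCode_iff hℓ hh).1 (hD₁ _ (List.mem_map.2 ⟨e, he, rfl⟩)).2⟩
  · obtain ⟨_, heD, hpe⟩ := hD₂ _ (codePairs_mem_iff.2 ⟨p, hp, rfl⟩)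
    obtain ⟨e, he, rfl⟩ := List.mem_map.1 heD
    exact ⟨e, he, pairLE_iff.2 hpe⟩
  · obtain ⟨e, e', he, he', hee⟩ := (hD₃ i (by simpa using hi) j (by simpa using hj)).resolve_left
      hij
    rw [List.getElem?_map, List.getElem?_eq_getElem hi, Option.map_some, Option.some_inj] at he
    rw [List.getElem?_map, List.getElem?_eq_getElem hj, Option.map_some, Option.some_inj] at he'
    subst he he'
    obtain ⟨ℓ, hℓ⟩ := hcut _ (hEP _ (List.getElem_mem hj))
    exact (not_pairLE_iff hℓ).2 hee

end StdPairs

theorem mainTheorem11 :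
    ∃ alg : ℕ × List (List ℤ) × List (List ℤ × List (List ℤ)) →.
        List (List (List ℤ × List (List ℤ)) × List (List ℤ)),
      Partrec alg ∧
      ∀ (d : ℕ) (A : List (Pt d)), (∀ a ∈ A, a ≠ 0) → StronglyConvex (listSet A) →
      ∀ P : List (Pt d × List (Pt d)),
      ∀ (k : Type*) [Field k] [Infinite k] (I : Ideal (SemigpRing k (listSet A))),
        IsMonomialIdeal I → ListsPairs P (stdPairs I) →
        ∃ C : List (List (Pt d × List (Pt d)) × List (Pt d)),
          codeComponents C ∈ alg (d, codePts A, codePairs P) ∧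
          ∃ J : Fin C.length → Ideal (SemigpRing k (listSet A)),
            IsIrreducibleDecomposition I J ∧
            ∀ i, ListsPairs (C.get i).1 (stdPairs (J i)) ∧ ListsGenerators (C.get i).2 (J i) := by
  obtain ⟨f, hf, hfspec⟩ := Semidec.exists_partrec
    (α := ℕ × List (List ℤ) × List (List ℤ × List (List ℤ))) (β := List (Entry (List ℤ)))
    (p := fun x D => ValidCode x.1 x.2.1 x.2.2 D) (Semidec.validCode
    (.comp .fst .fst) (.comp .fst (.comp .snd .fst)) (.comp .snd (.comp .snd .fst)) .snd)
  refine ⟨fun x => (f x).map fun D => D.map component,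
    hf.map (primrec_map_component.to_comp.comp .snd).to₂, ?_⟩
  intro d A hA0 hconv P k _ _ I hI hP
  have hA : (listSet A).Finite := List.finite_toSet A
  have hface : IsFace (listSet A) ∅ := isFace_empty hA0 hconv
  obtain ⟨h, hh⟩ := hface.exists_cutsOut hA
  have hPstd : ∀ p ∈ P, toPair p ∈ stdPairs I := fun p hp => hP ▸ ⟨p, hp, rfl⟩
  have hPpair : ∀ p ∈ P, IsPair (listSet A) (toPair p) := fun p hp => (hPstd p hp).1.1
  -- Termination uses only that `P` lists pairs of `A`; that they are the standard pairs of `I`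
  -- matters only for the decomposition.
  obtain ⟨D, hDf, hD⟩ := hfspec (d, codePts A, codePairs P) (exists_validCode hh hPpair)
  obtain ⟨E, rfl, hE, hcov, hirr⟩ := ValidCode.exists_entries hh hPpair hD
  have hlen : (E.map component).length = E.length := List.length_map _
  refine ⟨E.map component, ?_, fun i => irrIdeal k (listSet A)
    (toPair (E.get (i.cast hlen)).1).2 (toPair (E.get (i.cast hlen)).1).1, ?_, fun i => ?_⟩
  · rw [codeComponents_map_component]
    exact Part.mem_map _ hDf
  · refine isIrreducibleDecomposition_irrIdeal hA hh hface hI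
      (fun i => toPair (E.get (i.cast hlen)).1)
      (fun i => hPstd _ (hE _ (List.get_mem _ _)).1) ?_ ?_
    · intro p hp
      rw [← hP] at hp
      obtain ⟨p, hp, rfl⟩ := hp
      obtain ⟨e, he, hpe⟩ := hcov p hp
      obtain ⟨n, hn, rfl⟩ := List.mem_iff_getElem.1 he
      exact ⟨⟨n, hlen ▸ hn⟩, hpe⟩
    · exact fun i j hij => hirr _ _ _ _ fun hv => hij (Fin.ext hv)
  · obtain ⟨heP, hcomp⟩ := hE _ (List.get_mem E (i.cast hlen))
    have hF := (hPpair _ heP).2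
    obtain ⟨ℓ, hℓ⟩ := hF.exists_cutsOut hA
    have hget : (E.map component).get i = component (E.get (i.cast hlen)) := by simp
    rw [hget]
    refine ⟨?_, fun g hg => (hcomp.gens g hg).1, hcomp.irrIdeal_eq k hF.subset⟩
    refine Eq.trans ?_ (hcomp.stdPairs_eq k hℓ hh hF).symm
    ext q
    simp only [component, Set.mem_image, listSet, Set.mem_ofPred_eq, List.mem_map]
    constructor
    · rintro ⟨_, ⟨b, hb, rfl⟩, rfl⟩
      exact ⟨b, hb, rfl⟩
    · rintro ⟨b, hb, rfl⟩
      exact ⟨_, ⟨b, hb, rfl⟩, rfl⟩
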